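/- Let $N\in\{1,2,3\}$, let $\Omega\subset\mathbb R^N$ be a bounded connected (nonempty) open set with smooth boundary, let $T>0$ and $\tau>0$. Put $H=L^2(\Omega)$, $V=H^1(\Omega)$, $W=\{v\in H^2(\Omega):\partial_{\mathbf n}v=0 \text{ on }\partial\Omega\}$, write $(\cdot,\cdot)$ for the inner product of $H$, and identify $H$ with a subspace of $V^*$ by $\langle u,v\rangle=(u,v)$ for $u\in H$, $v\in V$. Let $f_1:\mathbb R\to[0,+\infty]$ be convex and lower semicontinuous with $f_1(0)=0$, such that $0$ is an interior point of the domain $D(\partial f_1)$ of its subdifferential, and let $f_2:\mathbb R\to\mathbb R$ be differentiable with Lipschitz continuous derivative $f_2'$, with Lipschitz constant $L$. For $r\in D(\partial f_1)$ let $\partial f_1^\circ(r)$ be the element of $\partial f_1(r)$ of minimum modulus. A quadruple $(g,\mu_0,\nu_0,\phi_0)$ is called admissible if $g\in H^1(0,T;H)$, $\mu_0\in V$, $\nu_0\in H$, $\phi_0\in W$, $\phi_0\in D(\partial f_1)$ a.e. in $\Omega$ with $\partial f_1^\circ(\phi_0)\in H$, and the mean value $\frac1{|\Omega|}\int_\Omega\phi_0$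 lies in the interior of $D(\partial f_1)$. For $0<\alpha\le 1$ and admissible data, a solution is a triple $(\mu,\phi,\xi)$ with $$\mu\in W^{2,\infty}(0,T;V^*)\cap W^{1,\infty}(0,T;H)\cap L^\infty(0,T;V),\quad \phi\in W^{1,\infty}(0,T;H)\cap H^1(0,T;V)\cap L^\infty(0,T;W),\quad \xi\in L^\infty(0,T;H),$$ such that, for a.e. $t\in(0,T)$ and every $v\in V$, $$\alpha\langle\partial_{tt}\mu(t),v\rangle+(\partial_t\phi(t),v)+\int_\Omega\nabla\mu(t)\cdot\nabla v=0,$$ $$\tau(\partial_t\phi(t),v)+\int_\Omega\nabla\phi(t)\cdot\nabla v+(\xi(t)+f_2'(\phi(t)),v)=(\mu(t)+g(t),v),$$ $\xi\in\partial f_1(\phi)$ a.e. in $\Omega\times(0,T)$, and $\mu(0)=\mu_0$, $(\partial_t\mu)(0)=\nu_0$, $\phi(0)=\phi_0$ (in the sense of the time-continuous representatives of $\mu$ and $\phi$ with values in $H$ and of $\partial_t\mu$ with values in $V^*$). **Theorem.** (i) There is a constant $K_2>0$ depending only on $\Omega$, $T$, $\tau$ and $L$ (in particular not on $\alpha$)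 such that the following holds for all such $f_1,f_2$ and all $\alpha\in(0,1]$. If $(\mu_i,\phi_i,\xi_i)$ is a solution for the admissible data $(g_i,\mu_{0,i},\nu_{0,i},\phi_{0,i})$, $i=1,2$, then, with $(1*v)(t)=\int_0^t v(s)\,ds$, $$\alpha^{1/2}\|\mu_1-\mu_2\|_{L^\infty(0,T;H)}+\|\nabla(1*(\mu_1-\mu_2))\|_{L^\infty(0,T;H)}+\|\phi_1-\phi_2\|_{L^\infty(0,T;H)}+\|\phi_1-\phi_2\|_{L^2(0,T;V)}$$ $$\le K_2\Bigl(\|g_1-g_2\|_{L^2(0,T;H)}+\alpha^{1/2}\|\mu_{0,1}-\mu_{0,2}\|_H+\alpha^{1/2}\|\nu_{0,1}-\nu_{0,2}\|_H\Bigr)+K_2\bigl(1+\alpha^{-1/2}\bigr)\|\phi_{0,1}-\phi_{0,2}\|_H .$$ (ii) For every such $f_1,f_2$, every $\alpha\in(0,1]$ and every admissible quadruple of data there is at most one solution $(\mu,\phi,\xi)$. -/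

import Mathlib

open MeasureTheory Set
open scoped ENNReal NNReal ContDiff

noncomputable section

namespace HypRelax

/-! ### The domain and the spaces `H`, `V`, `W` -/

/-- `Ω` is a nonempty, bounded, connected open subset of `ℝᴺ` with `C^∞` boundary: near each of
its boundary points, `Ω` is the sublevel set of a smooth function with nonvanishing differential
at that point (so that `Ω` lies locally on one side of the smooth hypersurface `∂Ω`). -/
structure IsSmoothDomain {N : ℕ} (Ω : Set (EuclideanSpace ℝ (Fin N))) : Prop where
  isOpen : IsOpen Ω
  isConnected : IsConnected Ω
  isBounded : Bornology.IsBounded Ω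
  smooth_boundary : ∀ x ∈ frontier Ω,
    ∃ (U : Set (EuclideanSpace ℝ (Fin N))) (ρ : EuclideanSpace ℝ (Fin N) → ℝ),
      IsOpen U ∧ x ∈ U ∧ ContDiffOn ℝ ∞ ρ U ∧ fderiv ℝ ρ x ≠ 0 ∧ Ω ∩ U = {y ∈ U | ρ y < 0}

/-- Real test functions `ψ ∈ C_c^∞(O)`. -/
structure IsTest {E : Type*} [NormedAddCommGroup E] [NormedSpace ℝ E]
    (O : Set E) (ψ : E → ℝ) : Prop where
  smooth : ContDiff ℝ ∞ ψ
  compact : HasCompactSupport ψ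
  support : tsupport ψ ⊆ O

/-- The partial derivative `∂ψ/∂xᵢ`. -/
def partialDeriv {N : ℕ} (i : Fin N) (ψ : EuclideanSpace ℝ (Fin N) → ℝ)
    (x : EuclideanSpace ℝ (Fin N)) : ℝ :=
  fderiv ℝ ψ x (EuclideanSpace.single i 1)

section Spaces

variable {N : ℕ} (Ω : Set (EuclideanSpace ℝ (Fin N)))

/-- `L²(Ω; F)`. -/
abbrev L2 (F : Type) [NormedAddCommGroup F] : Type :=
  Lp F 2 (volume.restrict Ω : Measure (EuclideanSpace ℝ (Fin N)))

/-- `H = L²(Ω)`. -/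
abbrev H : Type := L2 Ω ℝ

/-- `L²(Ω)ᴺ`, the space of square integrable vector fields. -/
abbrev HVec : Type := L2 Ω (EuclideanSpace ℝ (Fin N))

/-- `L²(Ω)^{N × N}`, the space of square integrable matrix fields. -/
abbrev HMat : Type := L2 Ω (EuclideanSpace ℝ (Fin N × Fin N))

variable {Ω}

/-- `G` is the weak gradient of `u` in `Ω`. -/
def HasWeakGradient (u : H Ω) (G : HVec Ω) : Prop :=
  ∀ ψ, IsTest Ω ψ → ∀ i : Fin N,
    ∫ x in Ω, u x * partialDeriv i ψ x = - ∫ x in Ω, G x i * ψ x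

/-- `D` is the weak Jacobian matrix of the vector field `G` in `Ω`: `D i j = ∂ⱼ Gᵢ`. -/
def HasWeakJacobian (G : HVec Ω) (D : HMat Ω) : Prop :=
  ∀ ψ, IsTest Ω ψ → ∀ i j : Fin N,
    ∫ x in Ω, G x i * partialDeriv j ψ x = - ∫ x in Ω, D x (i, j) * ψ x

/-- Pairing an `L²` function with a fixed `L²` weight through a fixed functional is linear and
continuous. -/
theorem exists_pairing {F : Type} [NormedAddCommGroup F] [NormedSpace ℝ F] (l : F →L[ℝ] ℝ)
    (w : EuclideanSpace ℝ (Fin N) → ℝ) (hw : MemLp w 2 (volume.restrict Ω)) :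
    ∃ L : L2 Ω F →L[ℝ] ℝ, ∀ u : L2 Ω F, L u = ∫ x in Ω, l (u x) * w x := by
  refine ⟨(innerSL ℝ (hw.toLp w)).comp (l.compLpL 2 (volume.restrict Ω)), fun u => ?_⟩
  rw [ContinuousLinearMap.comp_apply, innerSL_apply_apply, MeasureTheory.L2.inner_def]
  refine integral_congr_ae ?_
  filter_upwards [hw.coeFn_toLp, l.coeFn_compLpL (p := 2) (μ := volume.restrict Ω) u] with x h1 h2
  rw [h1, h2]
  simp

theorem IsTest.memLp {ψ : EuclideanSpace ℝ (Fin N) → ℝ} (h : IsTest Ω ψ) :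
    MemLp ψ 2 (volume.restrict Ω) :=
  h.smooth.continuous.memLp_of_hasCompactSupport h.compact

theorem IsTest.memLp_partialDeriv {ψ : EuclideanSpace ℝ (Fin N) → ℝ} (h : IsTest Ω ψ)
    (i : Fin N) : MemLp (partialDeriv i ψ) 2 (volume.restrict Ω) := by
  refine Continuous.memLp_of_hasCompactSupport ?_ ?_
  · exact (h.smooth.continuous_fderiv (by simp)).clm_apply continuous_const
  · exact h.compact.fderiv_apply ℝ _

/-- The coordinate functional `x ↦ x i`. -/
abbrev coord {ι : Type} [Fintype ι] (i : ι) : EuclideanSpace ℝ ι →L[ℝ] ℝ :=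
  EuclideanSpace.proj i

variable (Ω)

/-- `V = H¹(Ω)`, realized as the space of pairs `(u, ∇u)` in `L²(Ω) × L²(Ω)ᴺ`; its norm is
`‖u‖²_V = ‖u‖² + ‖∇u‖²`. -/
def V : Submodule ℝ (WithLp 2 (H Ω × HVec Ω)) where
  carrier := {p | HasWeakGradient p.fst p.snd}
  zero_mem' := by
    intro ψ hψ i
    obtain ⟨L, hL⟩ := exists_pairing (Ω := Ω) (ContinuousLinearMap.id ℝ ℝ) _
      (hψ.memLp_partialDeriv i)
    obtain ⟨M, hM⟩ := exists_pairing (Ω := Ω) (coord i) _ hψ.memLp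
    have h1 := hL 0
    have h2 := hM 0
    simp only [ContinuousLinearMap.id_apply, PiLp.proj_apply, map_zero] at h1 h2
    simp only [WithLp.zero_fst, WithLp.zero_snd, ← h1, ← h2, neg_zero]
  add_mem' := by
    intro p q hp hq ψ hψ i
    obtain ⟨L, hL⟩ := exists_pairing (Ω := Ω) (ContinuousLinearMap.id ℝ ℝ) _
      (hψ.memLp_partialDeriv i)
    obtain ⟨M, hM⟩ := exists_pairing (Ω := Ω) (coord i) _ hψ.memLp
    simp only [ContinuousLinearMap.id_apply, PiLp.proj_apply] at hL hM
    have h1 := hp ψ hψ i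
    have h2 := hq ψ hψ i
    rw [← hL, ← hM] at h1 h2 ⊢
    rw [WithLp.add_fst, WithLp.add_snd, map_add, map_add, h1, h2, neg_add]
  smul_mem' := by
    intro c p hp ψ hψ i
    obtain ⟨L, hL⟩ := exists_pairing (Ω := Ω) (ContinuousLinearMap.id ℝ ℝ) _
      (hψ.memLp_partialDeriv i)
    obtain ⟨M, hM⟩ := exists_pairing (Ω := Ω) (coord i) _ hψ.memLp
    simp only [ContinuousLinearMap.id_apply, PiLp.proj_apply] at hL hM
    have h1 := hp ψ hψ i
    rw [← hL, ← hM] at h1 ⊢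
    rw [WithLp.smul_fst, WithLp.smul_snd, map_smul, map_smul, h1, smul_neg]

theorem isClosed_V : IsClosed (V Ω : Set (WithLp 2 (H Ω × HVec Ω))) := by
  have : (V Ω : Set (WithLp 2 (H Ω × HVec Ω))) =
      ⋂ (ψ) (_ : IsTest Ω ψ) (i : Fin N), {p | ∫ x in Ω, p.fst x * partialDeriv i ψ x
        = - ∫ x in Ω, p.snd x i * ψ x} := by
    ext p
    simp only [mem_iInter]
    exact Iff.rfl
  rw [this]
  refine isClosed_iInter fun ψ => isClosed_iInter fun hψ => isClosed_iInter fun i => ?_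
  obtain ⟨L, hL⟩ := exists_pairing (Ω := Ω) (ContinuousLinearMap.id ℝ ℝ) _
    (hψ.memLp_partialDeriv i)
  obtain ⟨M, hM⟩ := exists_pairing (Ω := Ω) (coord i) _ hψ.memLp
  simp only [ContinuousLinearMap.id_apply, PiLp.proj_apply] at hL hM
  simp only [← hL, ← hM]
  refine isClosed_eq (L.continuous.comp ?_) (M.continuous.comp ?_).neg
  · exact (WithLp.fstL 2 ℝ (H Ω) (HVec Ω)).continuous
  · exact (WithLp.sndL 2 ℝ (H Ω) (HVec Ω)).continuous

/-- `V` is a Hilbert space; hence the Bochner integral of `V`-valued functions is meaningful. -/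
instance : CompleteSpace (V Ω) := (isClosed_V Ω).completeSpace_coe

/-- The embedding `V ⊂ H`. -/
def toH : V Ω →L[ℝ] H Ω := (WithLp.fstL 2 ℝ (H Ω) (HVec Ω)).comp (V Ω).subtypeL

/-- The gradient `V → L²(Ω)ᴺ`. -/
def grad : V Ω →L[ℝ] HVec Ω := (WithLp.sndL 2 ℝ (H Ω) (HVec Ω)).comp (V Ω).subtypeL

/-- The dual space `V*`, with the dual norm. -/
abbrev VDual : Type := V Ω →L[ℝ] ℝ

variable {Ω}

/-- The embedding `H ⊂ V*`, `⟨u, v⟩ = (u, v)`. -/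
def toVDual (u : H Ω) : VDual Ω := (innerSL ℝ u).comp (toH Ω)

/-- The homogeneous Neumann condition `∂ₙ u = 0` on `∂Ω` for a function with gradient `G` and
Hessian `D`: the normal trace of `G`, which is defined through Green's formula
`⟨∂ₙ u, w⟩ = ∫_Ω (Δu) w + ∫_Ω ∇u · ∇w` for `w ∈ H¹(Ω)`, vanishes. -/
def NeumannZero (G : HVec Ω) (D : HMat Ω) : Prop :=
  ∀ w : V Ω, (∑ i : Fin N, ∫ x in Ω, D x (i, i) * toH Ω w x) + inner ℝ G (grad Ω w) = 0

variable (Ω)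

/-- `W = {u ∈ H²(Ω) : ∂ₙ u = 0 on ∂Ω}`, realized as the space of pairs `(u, D²u)` with `u ∈ V`;
its norm is the `H²` norm `‖u‖²_W = ‖u‖² + ‖∇u‖² + ‖D²u‖²`. -/
def W : Submodule ℝ (WithLp 2 (V Ω × HMat Ω)) where
  carrier := {p | HasWeakJacobian (grad Ω p.fst) p.snd ∧ NeumannZero (grad Ω p.fst) p.snd}
  zero_mem' := by
    constructor
    · intro ψ hψ i j
      obtain ⟨L, hL⟩ := exists_pairing (Ω := Ω) (coord i) _ (hψ.memLp_partialDeriv j)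
      obtain ⟨M, hM⟩ := exists_pairing (Ω := Ω) (coord (i, j)) _ hψ.memLp
      simp only [PiLp.proj_apply] at hL hM
      rw [← hL, ← hM]
      simp
    · intro w
      have h : ∀ i : Fin N, ∫ x in Ω, (0 : HMat Ω) x (i, i) * toH Ω w x = 0 := by
        intro i
        obtain ⟨M, hM⟩ := exists_pairing (Ω := Ω) (coord (i, i)) _ (Lp.memLp (toH Ω w))
        simp only [PiLp.proj_apply] at hM
        rw [← hM, map_zero]
      simp only [WithLp.zero_fst, WithLp.zero_snd, h, map_zero, inner_zero_left,
        Finset.sum_const_zero, add_zero]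
  add_mem' := by
    intro p q hp hq
    constructor
    · intro ψ hψ i j
      obtain ⟨L, hL⟩ := exists_pairing (Ω := Ω) (coord i) _ (hψ.memLp_partialDeriv j)
      obtain ⟨M, hM⟩ := exists_pairing (Ω := Ω) (coord (i, j)) _ hψ.memLp
      simp only [PiLp.proj_apply] at hL hM
      have h1 := hp.1 ψ hψ i j
      have h2 := hq.1 ψ hψ i j
      rw [← hL, ← hM] at h1 h2 ⊢
      rw [WithLp.add_fst, WithLp.add_snd, map_add, map_add, map_add, h1, h2, neg_add]
    · intro w
      have h : ∀ i : Fin N, ∫ x in Ω, (p.snd + q.snd) x (i, i) * toH Ω w x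
          = (∫ x in Ω, p.snd x (i, i) * toH Ω w x) + ∫ x in Ω, q.snd x (i, i) * toH Ω w x := by
        intro i
        obtain ⟨M, hM⟩ := exists_pairing (Ω := Ω) (coord (i, i)) _ (Lp.memLp (toH Ω w))
        simp only [PiLp.proj_apply] at hM
        rw [← hM, ← hM, ← hM, map_add]
      have h1 := hp.2 w
      have h2 := hq.2 w
      simp only [WithLp.add_fst, WithLp.add_snd, h, map_add, inner_add_left,
        Finset.sum_add_distrib]
      linarith
  smul_mem' := by
    intro c p hp
    constructor
    · intro ψ hψ i j
      obtain ⟨L, hL⟩ := exists_pairing (Ω := Ω) (coord i) _ (hψ.memLp_partialDeriv j)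
      obtain ⟨M, hM⟩ := exists_pairing (Ω := Ω) (coord (i, j)) _ hψ.memLp
      simp only [PiLp.proj_apply] at hL hM
      have h1 := hp.1 ψ hψ i j
      rw [← hL, ← hM] at h1 ⊢
      rw [WithLp.smul_fst, WithLp.smul_snd, map_smul, map_smul, map_smul, h1, smul_neg]
    · intro w
      have h : ∀ i : Fin N, ∫ x in Ω, (c • p.snd) x (i, i) * toH Ω w x
          = c * ∫ x in Ω, p.snd x (i, i) * toH Ω w x := by
        intro i
        obtain ⟨M, hM⟩ := exists_pairing (Ω := Ω) (coord (i, i)) _ (Lp.memLp (toH Ω w))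
        simp only [PiLp.proj_apply] at hM
        rw [← hM, ← hM, map_smul, smul_eq_mul]
      have h1 := hp.2 w
      simp only [WithLp.smul_fst, WithLp.smul_snd, h, map_smul, real_inner_smul_left,
        ← Finset.mul_sum]
      rw [← mul_add, h1, mul_zero]

/-- The embedding `W ⊂ V`. -/
def toV : W Ω →L[ℝ] V Ω := (WithLp.fstL 2 ℝ (V Ω) (HMat Ω)).comp (W Ω).subtypeL

end Spaces

/-! ### Functions of time with values in a Banach space -/

section Time

variable {X : Type*} [NormedAddCommGroup X] [NormedSpace ℝ X]

/-- Lebesgue measure on the time interval `(0,T)`. The space `L^p(0,T;X)` consists of (the classes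
of) the functions `u` with `MemLp u p (timeMeasure T)`, normed by `eLpNorm u p (timeMeasure T)`. -/
abbrev timeMeasure (T : ℝ) : Measure ℝ := volume.restrict (Ioo 0 T)

/-- `u'` is the distributional derivative of `u` on `(0,T)`. -/
def HasWeakTimeDeriv (T : ℝ) (u u' : ℝ → X) : Prop :=
  ∀ ψ : ℝ → ℝ, IsTest (Ioo 0 T) ψ →
    ∫ t, deriv ψ t • u t ∂(timeMeasure T) = - ∫ t, ψ t • u' t ∂(timeMeasure T)

/-- `u(0) = x`: the class of `u` has a representative in `C⁰([0,T];X)` with value `x` at `0`. -/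
def HasInitialValue (T : ℝ) (u : ℝ → X) (x : X) : Prop :=
  ∃ c : ℝ → X, ContinuousOn c (Icc 0 T) ∧ c =ᵐ[timeMeasure T] u ∧ c 0 = x

/-- The convolution `(1 * u)(t) = ∫₀ᵗ u(s) ds`. -/
def oneConv (u : ℝ → X) (t : ℝ) : X := ∫ s in (0 : ℝ)..t, u s

end Time

/-! ### The nonlinearity -/

/-- The subdifferential `∂f₁(r)` of `f₁ : ℝ → [0,+∞]`. -/
def subdiff (f₁ : ℝ → ℝ≥0∞) (r : ℝ) : Set ℝ :=
  {s | ∀ y : ℝ, (f₁ r : EReal) + ((s * (y - r) : ℝ) : EReal) ≤ (f₁ y : EReal)}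

/-- The domain `D(∂f₁)`. -/
def subdiffDomain (f₁ : ℝ → ℝ≥0∞) : Set ℝ := {r | (subdiff f₁ r).Nonempty}

/-- `s = ∂f₁°(r)`, the element of `∂f₁(r)` with minimum modulus. -/
def IsMinimalSection (f₁ : ℝ → ℝ≥0∞) (r s : ℝ) : Prop :=
  s ∈ subdiff f₁ r ∧ ∀ s' ∈ subdiff f₁ r, |s| ≤ |s'|

/-- The structural assumptions on `f = f₁ + f₂`, where `L` is a Lipschitz constant of `f₂'`. -/
structure IsPotential (f₁ : ℝ → ℝ≥0∞) (f₂ : ℝ → ℝ) (L : ℝ≥0) : Prop where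
  convex : ConvexOn ℝ≥0 univ f₁
  lsc : LowerSemicontinuous f₁
  zero : f₁ 0 = 0
  differentiable : Differentiable ℝ f₂
  lipschitz : LipschitzWith L (deriv f₂)
  zero_mem_interior : (0 : ℝ) ∈ interior (subdiffDomain f₁)

/-! ### Data and solutions -/

section Problem

variable {N : ℕ}

/-- Data `g, μ₀, ν₀, φ₀` with `μ₀ ∈ V`, `ν₀ ∈ H`, `φ₀ ∈ W`. -/
structure Data (Ω : Set (EuclideanSpace ℝ (Fin N))) where
  g : ℝ → H Ω
  μ₀ : V Ω
  ν₀ : H Ω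
  φ₀ : W Ω

/-- The remaining assumptions on the data: `g ∈ H¹(0,T;H)`, `φ₀ ∈ D(∂f₁)` with `∂f₁°(φ₀) ∈ H`,
and the mean value of `φ₀` lies in the interior of `D(∂f₁)`. -/
structure Data.IsAdmissible {Ω : Set (EuclideanSpace ℝ (Fin N))} (d : Data Ω) (T : ℝ)
    (f₁ : ℝ → ℝ≥0∞) : Prop where
  g_mem : MemLp d.g 2 (timeMeasure T)
  g_deriv : ∃ g' : ℝ → H Ω, MemLp g' 2 (timeMeasure T) ∧ HasWeakTimeDeriv T d.g g'
  φ₀_minimal : ∃ ζ : H Ω, ∀ᵐ x ∂(volume.restrict Ω),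
    IsMinimalSection f₁ (toH Ω (toV Ω d.φ₀) x) (ζ x)
  φ₀_mean : (⨍ x in Ω, toH Ω (toV Ω d.φ₀) x) ∈ interior (subdiffDomain f₁)

/-- `(μ, φ, ξ)` solves the problem, where `μt = ∂ₜμ`, `μtt = ∂ₜₜμ` and `φt = ∂ₜφ`. -/
structure IsSolutionWith {Ω : Set (EuclideanSpace ℝ (Fin N))} (T α τ : ℝ) (f₁ : ℝ → ℝ≥0∞)
    (f₂ : ℝ → ℝ) (d : Data Ω) (μ : ℝ → V Ω) (φ : ℝ → W Ω) (ξ : ℝ → H Ω)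
    (μt : ℝ → H Ω) (μtt : ℝ → VDual Ω) (φt : ℝ → V Ω) : Prop where
  /-- `μ ∈ L^∞(0,T;V)` -/
  μ_mem : MemLp μ ∞ (timeMeasure T)
  /-- `μ ∈ W^{1,∞}(0,T;H)` -/
  μt_mem : MemLp μt ∞ (timeMeasure T)
  μt_deriv : HasWeakTimeDeriv T (fun t => toH Ω (μ t)) μt
  /-- `μ ∈ W^{2,∞}(0,T;V*)` -/
  μtt_mem : MemLp μtt ∞ (timeMeasure T)
  μtt_deriv : HasWeakTimeDeriv T (fun t => toVDual (μt t)) μtt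
  /-- `φ ∈ L^∞(0,T;W)` -/
  φ_mem : MemLp φ ∞ (timeMeasure T)
  /-- `φ ∈ H¹(0,T;V)` -/
  φt_mem : MemLp φt 2 (timeMeasure T)
  φt_deriv : HasWeakTimeDeriv T (fun t => toV Ω (φ t)) φt
  /-- `φ ∈ W^{1,∞}(0,T;H)` -/
  φt_mem_H : MemLp (fun t => toH Ω (φt t)) ∞ (timeMeasure T)
  /-- `ξ ∈ L^∞(0,T;H)` -/
  ξ_mem : MemLp ξ ∞ (timeMeasure T)
  /-- `α ⟨∂ₜₜμ, v⟩ + (∂ₜφ, v) + ∫_Ω ∇μ · ∇v = 0` -/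
  eq_first : ∀ᵐ t ∂(timeMeasure T), ∀ v : V Ω,
    α * μtt t v + inner ℝ (toH Ω (φt t)) (toH Ω v) + inner ℝ (grad Ω (μ t)) (grad Ω v) = 0
  /-- `τ (∂ₜφ, v) + ∫_Ω ∇φ · ∇v + (ξ + f₂'(φ), v) = (μ + g, v)` -/
  eq_second : ∀ᵐ t ∂(timeMeasure T), ∀ v : V Ω,
    τ * inner ℝ (toH Ω (φt t)) (toH Ω v) + inner ℝ (grad Ω (toV Ω (φ t))) (grad Ω v)
      + (inner ℝ (ξ t) (toH Ω v) + ∫ x in Ω, deriv f₂ (toH Ω (toV Ω (φ t)) x) * toH Ω v x)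
      = inner ℝ (toH Ω (μ t) + d.g t) (toH Ω v)
  /-- `ξ ∈ ∂f₁(φ)` a.e. in `Ω × (0,T)` -/
  inclusion : ∀ᵐ t ∂(timeMeasure T), ∀ᵐ x ∂(volume.restrict Ω),
    ξ t x ∈ subdiff f₁ (toH Ω (toV Ω (φ t)) x)
  init_μ : HasInitialValue T (fun t => toH Ω (μ t)) (toH Ω d.μ₀)
  init_μt : HasInitialValue T (fun t => toVDual (μt t)) (toVDual d.ν₀)
  init_φ : HasInitialValue T (fun t => toH Ω (toV Ω (φ t))) (toH Ω (toV Ω d.φ₀))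

/-- `(μ, φ, ξ)` is a solution of the problem with the data `d`, in the required regularity
class. -/
def IsSolution {Ω : Set (EuclideanSpace ℝ (Fin N))} (T α τ : ℝ) (f₁ : ℝ → ℝ≥0∞)
    (f₂ : ℝ → ℝ) (d : Data Ω) (μ : ℝ → V Ω) (φ : ℝ → W Ω) (ξ : ℝ → H Ω) : Prop :=
  ∃ (μt : ℝ → H Ω) (μtt : ℝ → VDual Ω) (φt : ℝ → V Ω),
    IsSolutionWith T α τ f₁ f₂ d μ φ ξ μt μtt φt

end Problem

end HypRelax

end

open HypRelax

/-!
Subtracting two solutions and writing `μ, φ, ξ, g` for the differences, one integrates the first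
equation over `(0,t)` and obtains
`α (∂ₜμ(t), v) + (φ(t), v) + (∇(1*μ)(t), ∇v) = (α ν₀ + φ₀, v)` for all `v ∈ V`.
With `v = μ(t)` here and `v = φ(t)` in the second equation, the coupling terms `(φ, μ)` cancel,
`ξ` drops out by monotonicity of `∂f₁`, and `f₂'` contributes at most `L ‖φ‖²`. Hence the energy
`E = (α/2) ‖μ‖² + (1/2) ‖∇(1*μ)‖² + (τ/2) ‖φ‖²` satisfies
`E' + ‖∇φ‖² ≤ (α ν₀ + φ₀, μ) + (g, φ) + L ‖φ‖²`, and Gronwall's lemma gives the estimate; the factor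
`α^(-1/2)` in front of `φ₀` comes from absorbing `(φ₀, μ)` in `(α/2) ‖μ‖²`. This is
`energy_estimate`, proved for abstract Hilbert spaces and applied to differences of solutions in
`IsSolutionWith.energy_estimate_sub`.

The time derivatives exist only in the weak sense. `HasWeakTimeDeriv.ae_eq_add_oneConv` represents a
function by its initial value plus the primitive of its weak derivative, and `norm_sq_add_oneConv`,
a consequence of Fubini's theorem, is the chain rule for the squared norm of such a primitive.

For equal data the estimate gives `μ₁ = μ₂` and `φ₁ = φ₂`, because the elements of `V` and `W` are
determined by their `L²` part. The second equation then gives `(ξ₁ - ξ₂, v) = 0` for all `v ∈ V`, so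
`ξ₁ = ξ₂`, since `V` contains all test functions.
-/

namespace HypRelax

/-! ### Vector-valued primitives and weak time derivatives -/

section TimeCalculus

variable {X Y Z : Type*} [NormedAddCommGroup X] [NormedSpace ℝ X] [NormedAddCommGroup Y]
  [NormedSpace ℝ Y] [NormedAddCommGroup Z] [NormedSpace ℝ Z]

theorem oneConv_eq_setIntegral (f : ℝ → X) {t : ℝ} (ht : 0 ≤ t) :
    oneConv f t = ∫ s in Ioc 0 t, f s :=
  intervalIntegral.integral_of_le ht

theorem integral_indicator_Iic_eq_oneConv (f : ℝ → X) {s t : ℝ} (hs : s ∈ Ioc 0 t) :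
    ∫ r in Ioc 0 t, (Iic s).indicator f r = oneConv f s := by
  rw [integral_indicator measurableSet_Iic, Measure.restrict_restrict measurableSet_Iic,
    oneConv_eq_setIntegral f hs.1.le]
  congr 2
  ext r
  simp only [mem_inter_iff, mem_Iic, mem_Ioc]
  exact ⟨fun ⟨h1, h2, _⟩ => ⟨h2, h1⟩, fun ⟨h1, h2⟩ => ⟨h2, h1, h2.trans hs.2⟩⟩

/-- Integration by parts for two primitives, with respect to a continuous bilinear map: Fubini's
theorem on the square `(0,t)²`, cut along the diagonal. -/
theorem integral_bilin_oneConv [CompleteSpace X] [CompleteSpace Y] [CompleteSpace Z]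
    (B : X →L[ℝ] Y →L[ℝ] Z) {f : ℝ → X} {g : ℝ → Y} {t : ℝ} (ht : 0 ≤ t)
    (hf : IntegrableOn f (Ioc 0 t)) (hg : IntegrableOn g (Ioc 0 t)) :
    IntegrableOn (fun s => B (f s) (oneConv g s)) (Ioc 0 t) ∧
    IntegrableOn (fun s => B (oneConv f s) (g s)) (Ioc 0 t) ∧
    (∫ s in Ioc 0 t, B (f s) (oneConv g s)) + ∫ s in Ioc 0 t, B (oneConv f s) (g s)
      = B (oneConv f t) (oneConv g t) := by
  set ν : Measure ℝ := volume.restrict (Ioc 0 t) with hν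
  have hP : Integrable (fun z : ℝ × ℝ => B (f z.1) (g z.2)) (ν.prod ν) :=
    Integrable.op_fst_snd (op := fun x y => B x y)
      B.continuous₂ ⟨‖B‖, fun x y => B.le_opNorm₂ x y⟩ hf hg
  set P₁ : ℝ × ℝ → Z := {z : ℝ × ℝ | z.2 ≤ z.1}.indicator (fun z => B (f z.1) (g z.2)) with hP₁
  set P₂ : ℝ × ℝ → Z := {z : ℝ × ℝ | z.1 ≤ z.2}.indicator (fun z => B (f z.1) (g z.2)) with hP₂
  have hI₁ : Integrable P₁ (ν.prod ν) :=
    hP.indicator (measurableSet_le measurable_snd measurable_fst)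
  have hI₂ : Integrable P₂ (ν.prod ν) :=
    hP.indicator (measurableSet_le measurable_fst measurable_snd)
  have h₁ : ∀ᵐ s ∂ν, ∫ r, P₁ (s, r) ∂ν = B (f s) (oneConv g s) := by
    filter_upwards [ae_restrict_mem measurableSet_Ioc] with s hs
    rw [← integral_indicator_Iic_eq_oneConv g hs,
      ← ContinuousLinearMap.integral_comp_comm _ (hg.indicator measurableSet_Iic)]
    refine integral_congr_ae (Filter.Eventually.of_forall fun r => ?_)
    by_cases h : r ≤ s <;> simp [hP₁, indicator, h]
  have h₂ : ∀ᵐ r ∂ν, ∫ s, P₂ (s, r) ∂ν = B (oneConv f r) (g r) := by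
    filter_upwards [ae_restrict_mem measurableSet_Ioc] with s hs
    rw [← integral_indicator_Iic_eq_oneConv f hs, ← B.flip_apply,
      ← ContinuousLinearMap.integral_comp_comm _ (hf.indicator measurableSet_Iic)]
    refine integral_congr_ae (Filter.Eventually.of_forall fun r => ?_)
    by_cases h : r ≤ s <;> simp [hP₂, indicator, h]
  refine ⟨(integrable_congr h₁).1 hI₁.integral_prod_left,
    (integrable_congr h₂).1 hI₂.integral_prod_right, ?_⟩
  rw [← integral_congr_ae h₁, ← integral_congr_ae h₂, ← integral_prod _ hI₁,
    ← integral_prod_symm _ hI₂, ← integral_add hI₁ hI₂, 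
    integral_prod (fun z => P₁ z + P₂ z) (hI₁.add hI₂),
    oneConv_eq_setIntegral f ht, oneConv_eq_setIntegral g ht, ← B.flip_apply,
    ← ContinuousLinearMap.integral_comp_comm _ hf]
  refine integral_congr_ae (Filter.Eventually.of_forall fun s => ?_)
  simp only [B.flip_apply]
  rw [← ContinuousLinearMap.integral_comp_comm _ hg]
  refine integral_congr_ae ?_
  -- On the diagonal both indicators equal one, but each of its sections is a null set.
  have hne : ∀ᵐ r ∂ν, r ≠ s := ae_restrict_of_ae (Measure.ae_ne volume s)
  filter_upwards [hne] with r hr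
  rcases lt_or_gt_of_ne hr with h | h
  · simp [hP₁, hP₂, h.le, h.not_ge]
  · simp [hP₁, hP₂, h.le, h.not_ge]

/-- The chain rule `‖u‖²' = 2 (u', u)` in integrated form, for `u = x + 1 * f`. -/
theorem norm_sq_add_oneConv {E : Type*} [NormedAddCommGroup E] [InnerProductSpace ℝ E]
    [CompleteSpace E] (x : E) {f : ℝ → E} {t : ℝ} (ht : 0 ≤ t) (hf : IntegrableOn f (Ioc 0 t)) :
    IntegrableOn (fun s => inner ℝ (f s) (x + oneConv f s)) (Ioc 0 t) ∧
    2 * (∫ s in Ioc 0 t, inner ℝ (f s) (x + oneConv f s)) = ‖x + oneConv f t‖ ^ 2 - ‖x‖ ^ 2 := by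
  obtain ⟨h1, -, h3⟩ := integral_bilin_oneConv (innerSL ℝ) ht hf hf
  change IntegrableOn (fun s => inner ℝ (f s) (oneConv f s)) (Ioc 0 t) at h1
  change (∫ s in Ioc 0 t, inner ℝ (f s) (oneConv f s))
    + (∫ s in Ioc 0 t, inner ℝ (oneConv f s) (f s)) = inner ℝ (oneConv f t) (oneConv f t) at h3
  have h4 : IntegrableOn (fun s => inner ℝ (f s) x) (Ioc 0 t) := hf.inner_const x
  have h5 : ∫ s in Ioc 0 t, inner ℝ (f s) x = inner ℝ x (oneConv f t) := by
    rw [oneConv_eq_setIntegral f ht, ← integral_inner hf]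
    exact integral_congr_ae (Filter.Eventually.of_forall fun s => real_inner_comm _ _)
  have h6 : ∫ s in Ioc 0 t, inner ℝ (oneConv f s) (f s)
      = ∫ s in Ioc 0 t, inner ℝ (f s) (oneConv f s) :=
    integral_congr_ae (Filter.Eventually.of_forall fun s => real_inner_comm _ _)
  have h7 : (fun s => inner ℝ (f s) (x + oneConv f s))
      = fun s => inner ℝ (f s) x + inner ℝ (f s) (oneConv f s) :=
    funext fun s => inner_add_right _ _ _
  rw [h7]
  refine ⟨h4.add h1, ?_⟩
  rw [integral_add h4 h1, h5, norm_add_sq_real]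
  rw [h6, real_inner_self_eq_norm_sq] at h3
  linarith

theorem integrableOn_Ioc_of_timeMeasure {X : Type*} [NormedAddCommGroup X] {T t : ℝ}
    (ht : t ≤ T) {f : ℝ → X}
    (hf : Integrable f (timeMeasure T)) : IntegrableOn f (Ioc 0 t) := by
  have : IntegrableOn f (Ioc 0 T) := (integrableOn_Ioc_iff_integrableOn_Ioo (by finiteness)).2 hf
  exact this.mono_set (Ioc_subset_Ioc_right ht)

theorem continuousOn_oneConv {T : ℝ} (hT : 0 ≤ T) {f : ℝ → X}
    (hf : Integrable f (timeMeasure T)) : ContinuousOn (oneConv f) (Icc 0 T) := by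
  have h : IntegrableOn f (uIcc 0 T) := by
    rw [uIcc_of_le hT]
    exact (integrableOn_Icc_iff_integrableOn_Ioo (by finiteness) (by finiteness)).2 hf
  have := intervalIntegral.continuousOn_primitive_interval h
  rwa [uIcc_of_le hT] at this

theorem integral_timeMeasure_eq {T : ℝ} (f : ℝ → X) :
    ∫ t, f t ∂(timeMeasure T) = ∫ t in Ioc 0 T, f t :=
  (integral_Ioc_eq_integral_Ioo).symm

theorem IsTest.exists_Icc {T : ℝ} (hT : 0 < T) {ψ : ℝ → ℝ} (h : IsTest (Ioo 0 T) ψ) :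
    ∃ a b, 0 < a ∧ b < T ∧ tsupport ψ ⊆ Icc a b := by
  have hc : IsCompact (tsupport ψ) := h.compact
  rcases (tsupport ψ).eq_empty_or_nonempty with he | hne
  · exact ⟨T, 0, hT, hT, by simp [he]⟩
  · have h1 := h.support (hc.sInf_mem hne)
    have h2 := h.support (hc.sSup_mem hne)
    exact ⟨_, _, h1.1, h2.2, fun x hx => ⟨csInf_le hc.bddBelow hx, le_csSup hc.bddAbove hx⟩⟩

theorem IsTest.oneConv_deriv {T : ℝ} {ψ : ℝ → ℝ} (h : IsTest (Ioo 0 T) ψ) (t : ℝ) :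
    oneConv (deriv ψ) t = ψ t := by
  have h0 : ψ 0 = 0 := image_eq_zero_of_notMem_tsupport fun h' => lt_irrefl _ (h.support h').1
  rw [oneConv, intervalIntegral.integral_deriv_eq_sub, h0, sub_zero]
  · exact fun x _ => (h.smooth.differentiable (by simp)).differentiableAt
  · exact ((h.smooth.continuous_deriv (by simp))).intervalIntegrable _ _

theorem IsTest.apply_end {T : ℝ} {ψ : ℝ → ℝ} (h : IsTest (Ioo 0 T) ψ) : ψ T = 0 :=
  image_eq_zero_of_notMem_tsupport fun h' => lt_irrefl _ (h.support h').2

/-- The primitive of a test function with vanishing integral is again a test function. -/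
theorem IsTest.oneConv {T : ℝ} (hT : 0 < T) {ψ : ℝ → ℝ} (h : IsTest (Ioo 0 T) ψ)
    (h0 : ∫ t, ψ t = 0) : IsTest (Ioo 0 T) (oneConv ψ) ∧ deriv (HypRelax.oneConv ψ) = ψ := by
  have hd : deriv (HypRelax.oneConv ψ) = ψ :=
    funext fun t => h.smooth.continuous.deriv_integral ψ 0 t
  obtain ⟨a, b, ha, hb, hab⟩ := h.exists_Icc hT
  have hz : ∀ t, t ∉ Icc a b → ψ t = 0 := fun t ht =>
    image_eq_zero_of_notMem_tsupport fun h' => ht (hab h')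
  have hsub : Function.support (HypRelax.oneConv ψ) ⊆ Icc a b := by
    intro t ht
    by_contra hn
    apply ht
    rcases lt_or_ge t a with h1 | h1
    · rw [HypRelax.oneConv, intervalIntegral.integral_congr (g := fun _ => (0 : ℝ)),
        intervalIntegral.integral_zero]
      intro s hs
      refine hz s fun hs' => ?_
      have := hs.2
      rcases le_sup_iff.1 this with h2 | h2 <;> linarith [hs'.1]
    · have h2 : b < t := not_le.1 fun h2 => hn ⟨h1, h2⟩
      rw [HypRelax.oneConv, intervalIntegral.integral_eq_integral_of_support_subset, h0]
      intro s hs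
      have : s ∈ Icc a b := by
        by_contra h3; exact hs (hz s h3)
      exact ⟨ha.trans_le this.1, this.2.trans h2.le⟩
  have hts : tsupport (HypRelax.oneConv ψ) ⊆ Icc a b := closure_minimal hsub isClosed_Icc
  refine ⟨⟨?_, ?_, fun t ht => ⟨ha.trans_le (hts ht).1, (hts ht).2.trans_lt hb⟩⟩, hd⟩
  · rw [contDiff_infty_iff_deriv, hd]
    refine ⟨fun t => ?_, h.smooth⟩
    exact (intervalIntegral.integral_hasDerivAt_right
      (h.smooth.continuous.intervalIntegrable _ _)
      h.smooth.continuous.stronglyMeasurable.stronglyMeasurableAtFilter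
      h.smooth.continuous.continuousAt).differentiableAt
  · exact isCompact_Icc.of_isClosed_subset (isClosed_tsupport _) hts

theorem IsTest.integral_timeMeasure {T : ℝ} {ψ : ℝ → ℝ} (h : IsTest (Ioo 0 T) ψ) :
    ∫ t, ψ t ∂(timeMeasure T) = ∫ t, ψ t := by
  refine setIntegral_eq_integral_of_forall_compl_eq_zero fun t ht => ?_
  exact image_eq_zero_of_notMem_tsupport fun h' => ht (h.support h')

theorem ae_eq_zero_of_forall_isTest {T : ℝ} [CompleteSpace X] {w : ℝ → X}
    (hw : Integrable w (timeMeasure T))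
    (h : ∀ ψ, IsTest (Ioo 0 T) ψ → ∫ t, ψ t • w t ∂(timeMeasure T) = 0) :
    ∀ᵐ t ∂(timeMeasure T), w t = 0 := by
  rw [ae_restrict_iff' measurableSet_Ioo]
  refine isOpen_Ioo.ae_eq_zero_of_integral_contDiff_smul_eq_zero
    (IntegrableOn.locallyIntegrableOn hw) fun ψ h1 h2 h3 => ?_
  rw [← h ψ ⟨h1, h2, h3⟩]
  refine (setIntegral_eq_integral_of_forall_compl_eq_zero fun t ht => ?_).symm
  rw [image_eq_zero_of_notMem_tsupport fun h' => ht (h3 h'), zero_smul]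

theorem IsTest.integrable_smul {T : ℝ} {ψ : ℝ → ℝ} (hψ : IsTest (Ioo 0 T) ψ) {w : ℝ → X}
    (hw : Integrable w (timeMeasure T)) : Integrable (fun t => ψ t • w t) (timeMeasure T) := by
  obtain ⟨C, hC⟩ := hψ.compact.exists_bound_of_continuous hψ.smooth.continuous
  exact hw.bdd_smul C hψ.smooth.continuous.aestronglyMeasurable
    (Filter.Eventually.of_forall hC)

theorem IsTest.integrable_deriv_smul {T : ℝ} {ψ : ℝ → ℝ} (hψ : IsTest (Ioo 0 T) ψ) {w : ℝ → X}
    (hw : Integrable w (timeMeasure T)) :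
    Integrable (fun t => deriv ψ t • w t) (timeMeasure T) := by
  have hc : Continuous (deriv ψ) := hψ.smooth.continuous_deriv (by simp)
  obtain ⟨C, hC⟩ := hψ.compact.deriv.exists_bound_of_continuous hc
  exact hw.bdd_smul C hc.aestronglyMeasurable (Filter.Eventually.of_forall hC)

/-- The du Bois-Reymond lemma: a function with vanishing weak derivative is constant. -/
theorem ae_eq_const_of_hasWeakTimeDeriv_zero {T : ℝ} (hT : 0 < T) [CompleteSpace X] {w : ℝ → X}
    (hw : Integrable w (timeMeasure T)) (h : HasWeakTimeDeriv T w fun _ => 0) :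
    ∃ c, ∀ᵐ t ∂(timeMeasure T), w t = c := by
  -- For suitable `k`, `ψ - k η` has integral zero, hence is the derivative of a test function.
  obtain ⟨η, hη1, hη2, hη3, hη4, hη5⟩ := exists_contDiff_tsupport_subset (n := ⊤)
    (Ioo_mem_nhds (half_pos hT) (half_lt_self hT))
  have hη : IsTest (Ioo 0 T) η := ⟨hη3, hη2, hη1⟩
  have hpos : 0 < ∫ t, η t := by
    refine hη3.continuous.integral_pos_of_hasCompactSupport_nonneg_nonzero hη2
      (fun t => (hη4 ⟨t, rfl⟩).1) (x := T / 2) ?_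
    rw [hη5]; exact one_ne_zero
  set m := ∫ t, η t with hm
  refine ⟨m⁻¹ • ∫ t, η t • w t ∂(timeMeasure T), ?_⟩
  set c := m⁻¹ • ∫ t, η t • w t ∂(timeMeasure T) with hc
  have key : ∀ᵐ t ∂(timeMeasure T), w t - c = 0 := by
    refine ae_eq_zero_of_forall_isTest (hw.sub (integrable_const c)) fun ψ hψ => ?_
    set k := m⁻¹ * ∫ t, ψ t with hk
    have hθ : IsTest (Ioo 0 T) (fun t => ψ t - k * η t) := by
      refine ⟨hψ.smooth.sub (contDiff_const.mul hη.smooth),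
        hψ.compact.sub (hη.compact.mul_left), ?_⟩
      refine (tsupport_sub _ _).trans (union_subset hψ.support ?_)
      exact (tsupport_mul_subset_right).trans hη.support
    have hψi : Integrable ψ := hψ.smooth.continuous.integrable_of_hasCompactSupport hψ.compact
    have hηi : Integrable η := hη.smooth.continuous.integrable_of_hasCompactSupport hη.compact
    have h0 : ∫ t, ψ t - k * η t = 0 := by
      rw [integral_sub hψi (hηi.const_mul k), integral_const_mul, ← hm, hk]
      field_simp
      ring
    obtain ⟨h1, h2⟩ := hθ.oneConv hT h0
    have h3 := h _ h1
    rw [h2] at h3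
    simp only [smul_zero, integral_zero, neg_zero, sub_smul, mul_smul] at h3
    have hkη : Integrable (fun t => k • η t • w t) (timeMeasure T) :=
      (hη.integrable_smul hw).smul k
    rw [integral_sub (hψ.integrable_smul hw) hkη, integral_smul,
      sub_eq_zero] at h3
    simp only [smul_sub]
    rw [integral_sub (hψ.integrable_smul hw) (hψ.integrable_smul (integrable_const c)),
      integral_smul_const, h3, hψ.integral_timeMeasure, hc, hk, smul_smul, mul_comm, sub_self]
  filter_upwards [key] with t ht using sub_eq_zero.1 ht

theorem hasWeakTimeDeriv_oneConv {T : ℝ} (hT : 0 < T) [CompleteSpace X] {f : ℝ → X}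
    (hf : Integrable f (timeMeasure T)) : HasWeakTimeDeriv T (oneConv f) f := by
  intro ψ hψ
  have hd : IntegrableOn (deriv ψ) (Ioc 0 T) :=
    (hψ.smooth.continuous_deriv (by simp)).integrableOn_Ioc
  obtain ⟨-, -, h⟩ := integral_bilin_oneConv (ContinuousLinearMap.lsmul ℝ ℝ (E := X)) hT.le hd
    (integrableOn_Ioc_of_timeMeasure le_rfl hf)
  simp only [ContinuousLinearMap.lsmul_apply, hψ.oneConv_deriv, hψ.apply_end, zero_smul] at h
  rw [integral_timeMeasure_eq, integral_timeMeasure_eq]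
  exact eq_neg_of_add_eq_zero_left h

/-- A function with an integrable weak derivative is its initial value plus the primitive of that
derivative. -/
theorem HasWeakTimeDeriv.ae_eq_add_oneConv {T : ℝ} (hT : 0 < T) [CompleteSpace X] {u u' : ℝ → X}
    {x : X} (hu : Integrable u (timeMeasure T)) (hu' : Integrable u' (timeMeasure T))
    (h : HasWeakTimeDeriv T u u') (h0 : HasInitialValue T u x) :
    ∀ᵐ t ∂(timeMeasure T), u t = x + oneConv u' t := by
  have hcont := continuousOn_oneConv hT.le hu'
  have hint : Integrable (oneConv u') (timeMeasure T) :=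
    (hcont.integrableOn_Icc).mono_set Ioo_subset_Icc_self
  have hw : HasWeakTimeDeriv T (fun t => u t - oneConv u' t) fun _ => 0 := by
    intro ψ hψ
    simp only [smul_sub, smul_zero, integral_zero, neg_zero]
    rw [integral_sub (hψ.integrable_deriv_smul hu) (hψ.integrable_deriv_smul hint), h ψ hψ,
      hasWeakTimeDeriv_oneConv hT hu' ψ hψ, sub_self]
  obtain ⟨c, hc⟩ := ae_eq_const_of_hasWeakTimeDeriv_zero hT (hu.sub hint) hw
  obtain ⟨v, hv, hvu, hv0⟩ := h0
  have heq : EqOn v (fun t => c + oneConv u' t) (Icc 0 T) := by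
    refine Measure.eqOn_Icc_of_ae_eq volume hT.ne ?_ hv (continuousOn_const.add hcont)
    rw [restrict_Ioo_eq_restrict_Icc.symm]
    filter_upwards [hvu, hc] with t h1 h2
    rw [h1, ← h2]; exact (sub_add_cancel _ _).symm
  have hcx : c = x := by
    have := heq (left_mem_Icc.2 hT.le)
    simp only [hv0, oneConv, intervalIntegral.integral_same, add_zero] at this
    exact this.symm
  filter_upwards [hc] with t h1
  rw [← hcx, ← h1]; exact (sub_add_cancel _ _).symm

/-- Weak derivatives are unique. -/
theorem HasWeakTimeDeriv.ae_eq {T : ℝ} [CompleteSpace X] {u u₁ v v₁ : ℝ → X}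
    (hu : Integrable u₁ (timeMeasure T)) (hv : Integrable v₁ (timeMeasure T))
    (h : HasWeakTimeDeriv T u u₁) (h' : HasWeakTimeDeriv T v v₁)
    (huv : u =ᵐ[timeMeasure T] v) : u₁ =ᵐ[timeMeasure T] v₁ := by
  have : ∀ᵐ t ∂(timeMeasure T), u₁ t - v₁ t = 0 := by
    refine ae_eq_zero_of_forall_isTest (hu.sub hv) fun ψ hψ => ?_
    simp only [smul_sub]
    rw [integral_sub (hψ.integrable_smul hu) (hψ.integrable_smul hv), sub_eq_zero,
      ← neg_inj, ← h ψ hψ, ← h' ψ hψ]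
    refine integral_congr_ae ?_
    filter_upwards [huv] with t ht
    rw [ht]
  filter_upwards [this] with t ht using sub_eq_zero.1 ht

theorem ae_restrict_Ioc_of_timeMeasure {T t : ℝ} (ht : t ≤ T) {p : ℝ → Prop}
    (h : ∀ᵐ s ∂(timeMeasure T), p s) : ∀ᵐ s ∂(volume.restrict (Ioc 0 t)), p s := by
  rw [timeMeasure, restrict_Ioo_eq_restrict_Ioc] at h
  exact ae_restrict_of_ae_restrict_of_subset (Ioc_subset_Ioc_right ht) h

theorem HasWeakTimeDeriv.clm_comp {X Y : Type*} [NormedAddCommGroup X] [NormedSpace ℝ X]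
    [CompleteSpace X] [NormedAddCommGroup Y] [NormedSpace ℝ Y] [CompleteSpace Y] (l : X →L[ℝ] Y)
    {T : ℝ} {u u' : ℝ → X} (hu : Integrable u (timeMeasure T))
    (hu' : Integrable u' (timeMeasure T)) (h : HasWeakTimeDeriv T u u') :
    HasWeakTimeDeriv T (fun t => l (u t)) fun t => l (u' t) := by
  intro ψ hψ
  simp only [← map_smul]
  rw [l.integral_comp_comm (hψ.integrable_deriv_smul hu), l.integral_comp_comm
    (hψ.integrable_smul hu'), h ψ hψ, map_neg]

theorem oneConv_sub {X : Type*} [NormedAddCommGroup X] [NormedSpace ℝ X] {T t : ℝ} {u v : ℝ → X}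
    (hu : Integrable u (timeMeasure T)) (hv : Integrable v (timeMeasure T)) (ht : t ∈ Ioo 0 T) :
    oneConv (fun s => u s - v s) t = oneConv u t - oneConv v t := by
  simp only [oneConv_eq_setIntegral _ ht.1.le]
  exact integral_sub (integrableOn_Ioc_of_timeMeasure ht.2.le hu)
    (integrableOn_Ioc_of_timeMeasure ht.2.le hv)

theorem clm_oneConv {X Y : Type*} [NormedAddCommGroup X] [NormedSpace ℝ X]
    [CompleteSpace X] [NormedAddCommGroup Y] [NormedSpace ℝ Y] [CompleteSpace Y] (l : X →L[ℝ] Y)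
    {T t : ℝ} {u : ℝ → X} (hu : Integrable u (timeMeasure T)) (ht : t ∈ Ioo 0 T) :
    l (oneConv u t) = oneConv (fun s => l (u s)) t := by
  simp only [oneConv_eq_setIntegral _ ht.1.le]
  exact (l.integral_comp_comm (integrableOn_Ioc_of_timeMeasure ht.2.le hu)).symm

/-- Gronwall's lemma in integral form. -/
theorem gronwall_integral {T C A : ℝ} (hC : 0 ≤ C) {E : ℝ → ℝ} (hE : ContinuousOn E (Icc 0 T))
    (h : ∀ t ∈ Icc 0 T, E t ≤ A + C * ∫ s in (0 : ℝ)..t, E s) :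
    ∀ t ∈ Icc 0 T, E t ≤ A * Real.exp (C * t) := by
  intro t ht
  have hT : 0 ≤ T := ht.1.trans ht.2
  -- A continuous extension of `E`, so that its primitive is differentiable at the endpoints too.
  set F : ℝ → ℝ := IccExtend hT ((Icc 0 T).domRestrict E) with hF
  have hFE : ∀ s ∈ Icc 0 T, F s = E s := fun s hs => IccExtend_of_mem hT _ hs
  have hFc : Continuous F := (continuousOn_iff_continuous_domRestrict.1 hE).Icc_extend'
  have hint : ∀ s ∈ Icc 0 T, ∫ r in (0 : ℝ)..s, F r = ∫ r in (0 : ℝ)..s, E r := by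
    intro s hs
    refine intervalIntegral.integral_congr fun r hr => hFE r ?_
    rw [uIcc_of_le hs.1] at hr
    exact ⟨hr.1, hr.2.trans hs.2⟩
  have hder : ∀ s, HasDerivAt (fun t => A + C * ∫ r in (0 : ℝ)..t, F r) (C * F s) s := fun s =>
    ((intervalIntegral.integral_hasDerivAt_right (hFc.intervalIntegrable _ _)
      hFc.stronglyMeasurable.stronglyMeasurableAtFilter hFc.continuousAt).const_mul C).const_add A
  have hb : ∀ s ∈ Icc 0 T, F s ≤ A + C * ∫ r in (0 : ℝ)..s, F r := fun s hs => by
    rw [hFE s hs, hint s hs]; exact h s hs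
  have := le_gronwallBound_of_liminf_deriv_right_le (f := fun t => A + C * ∫ s in (0 : ℝ)..t, F s)
    (f' := fun s => C * F s) (δ := A) (K := C) (ε := 0) (a := 0) (b := T)
    (fun s _ => (hder s).continuousAt.continuousWithinAt)
    (fun s _ r hr => (hder s).hasDerivWithinAt.liminf_right_slope_le hr) (by simp)
    (fun s hs => by
      rw [add_zero]
      exact mul_le_mul_of_nonneg_left (hb s (Ico_subset_Icc_self hs)) hC) t ht
  rw [gronwallBound_ε0, sub_zero] at this
  rw [← hFE t ht]
  exact (hb t ht).trans this

end TimeCalculus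

/-! ### The energy estimate in abstract Hilbert spaces -/

/-- The pointwise bound behind `energy_estimate`: here `x` is the time derivative of the energy,
`a = ‖∇φ‖²`, and `q` is the norm of `∇(1*μ)`. -/
theorem energy_integrand_le {H : Type*} [NormedAddCommGroup H]
    [InnerProductSpace ℝ H] {α τ L a R : ℝ}
    (hα : 0 < α) (hτ : 0 < τ) (hL : 0 ≤ L)
    {m p n₀ p₀ r g : H} (hR : √α * ‖n₀‖ + ‖p₀‖ / √α ≤ R) (hr : -(L * ‖p‖ ^ 2) ≤ inner ℝ r p)
    (q : ℝ) {x : ℝ}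
    (hx : x = inner ℝ (α • n₀ + p₀) m + inner ℝ g p - inner ℝ r p - a) :
    x + a ≤ R ^ 2 / 2 + ‖g‖ ^ 2 / 2
      + (1 + (1 + 2 * L) / τ) * (α / 2 * ‖m‖ ^ 2 + 1 / 2 * q ^ 2 + τ / 2 * ‖p‖ ^ 2) := by
  have hs : 0 < √α := Real.sqrt_pos.2 hα
  have hs2 : √α * √α = α := Real.mul_self_sqrt hα.le
  have h1 : inner ℝ (α • n₀ + p₀) m ≤ R * (√α * ‖m‖) := by
    calc inner ℝ (α • n₀ + p₀) m ≤ ‖α • n₀ + p₀‖ * ‖m‖ := real_inner_le_norm _ _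
      _ ≤ (α * ‖n₀‖ + ‖p₀‖) * ‖m‖ := by
          gcongr
          refine (norm_add_le _ _).trans ?_
          rw [norm_smul, Real.norm_of_nonneg hα.le]
      _ = (√α * ‖n₀‖ + ‖p₀‖ / √α) * (√α * ‖m‖) := by
          have : (√α * ‖n₀‖ + ‖p₀‖ / √α) * (√α * ‖m‖)
              = √α * √α * ‖n₀‖ * ‖m‖ + ‖p₀‖ * ‖m‖ := by field_simp
          rw [this, hs2]
          ring
      _ ≤ R * (√α * ‖m‖) := by gcongr
  have h2 : inner ℝ g p ≤ ‖g‖ * ‖p‖ := real_inner_le_norm _ _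
  have h3 : R * (√α * ‖m‖) ≤ R ^ 2 / 2 + α / 2 * ‖m‖ ^ 2 := by
    nlinarith [sq_nonneg (R - √α * ‖m‖)]
  have h4 : ‖g‖ * ‖p‖ ≤ ‖g‖ ^ 2 / 2 + ‖p‖ ^ 2 / 2 := by nlinarith [sq_nonneg (‖g‖ - ‖p‖)]
  have h5 : (1 + 2 * L) / τ * (τ / 2 * ‖p‖ ^ 2) = ‖p‖ ^ 2 / 2 + L * ‖p‖ ^ 2 := by field_simp
  have h6 : 0 ≤ (1 + 2 * L) / τ * (α / 2 * ‖m‖ ^ 2 + 1 / 2 * q ^ 2) := by positivity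
  have h7 : 0 ≤ 1 / 2 * q ^ 2 + τ / 2 * ‖p‖ ^ 2 := by positivity
  rw [hx]
  linarith [h1, h2, h3, h4, h5, h6, h7, hr]

section Energy

variable {H V G : Type*} [NormedAddCommGroup H] [InnerProductSpace ℝ H] [CompleteSpace H]
  [NormedAddCommGroup V] [NormedSpace ℝ V]
  [NormedAddCommGroup G] [InnerProductSpace ℝ G] [CompleteSpace G]

/-- The constant `C` in the differential inequality `E' ≤ C E + …`. -/
noncomputable def energyRate (τ L : ℝ) : ℝ := 1 + (1 + 2 * L) / τ

/-- The bound for `E` on `[0,T]` given by Gronwall's lemma, for data of size at most `1`. -/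
noncomputable def energyBound (T τ L : ℝ) : ℝ := (1 + τ / 2 + T / 2) * Real.exp (energyRate τ L * T)

/-- The bound for `∫₀ᵀ ‖∇φ‖²`, for data of size at most `1`. -/
noncomputable def dissipationBound (T τ L : ℝ) : ℝ :=
  1 + τ / 2 + T / 2 + energyRate τ L * T * energyBound T τ L

theorem energyRate_nonneg {τ L : ℝ} (hτ : 0 ≤ τ) (hL : 0 ≤ L) : 0 ≤ energyRate τ L := by
  unfold energyRate; positivity

theorem energyBound_nonneg {T τ L : ℝ} (hT : 0 ≤ T) (hτ : 0 ≤ τ) :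
    0 ≤ energyBound T τ L := by
  unfold energyBound; positivity

theorem dissipationBound_nonneg {T τ L : ℝ} (hT : 0 ≤ T) (hτ : 0 ≤ τ) (hL : 0 ≤ L) :
    0 ≤ dissipationBound T τ L := by
  have := energyBound_nonneg (L := L) hT hτ
  have := energyRate_nonneg hτ hL
  unfold dissipationBound; positivity

/-- The energy estimate for the integrated first equation `h₁` and the second equation `h₂`, with
`P` in the role of the embedding `V ⊂ H`, `D` of the gradient, and `r` of the difference of the
nonlinear terms. The number `R` bounds the size of the data. -/
theorem energy_estimate (P : V →L[ℝ] H) (D : V →L[ℝ] G) {T α τ L R : ℝ} (hT : 0 < T)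
    (hα : 0 < α) (hτ : 0 < τ) (hL : 0 ≤ L)
    {μ φ φt : ℝ → V} {μt r g : ℝ → H} {m₀ n₀ p₀ : H}
    (hμ : Integrable μ (timeMeasure T)) (hφ : MemLp φ 2 (timeMeasure T))
    (hμt : Integrable μt (timeMeasure T)) (hφt : Integrable φt (timeMeasure T))
    (hg : MemLp g 2 (timeMeasure T))
    (hμ_eq : ∀ᵐ t ∂(timeMeasure T), P (μ t) = m₀ + oneConv μt t)
    (hφ_eq : ∀ᵐ t ∂(timeMeasure T), P (φ t) = p₀ + oneConv (fun s => P (φt s)) t)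
    (h₁ : ∀ᵐ t ∂(timeMeasure T), ∀ v : V, α * inner ℝ (μt t) (P v) + inner ℝ (P (φ t)) (P v)
      + inner ℝ (oneConv (fun s => D (μ s)) t) (D v) = inner ℝ (α • n₀ + p₀) (P v))
    (h₂ : ∀ᵐ t ∂(timeMeasure T), ∀ v : V, τ * inner ℝ (P (φt t)) (P v)
      + inner ℝ (D (φ t)) (D v) + inner ℝ (r t) (P v) = inner ℝ (P (μ t) + g t) (P v))
    (hr : ∀ᵐ t ∂(timeMeasure T), -(L * ‖P (φ t)‖ ^ 2) ≤ inner ℝ (r t) (P (φ t)))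
    (hm₀R : √α * ‖m₀‖ ≤ R) (hp₀R : ‖p₀‖ ≤ R) (hR : √α * ‖n₀‖ + ‖p₀‖ / √α ≤ R)
    (hgR : ∫ t, ‖g t‖ ^ 2 ∂(timeMeasure T) ≤ R ^ 2) :
    (∀ᵐ t ∂(timeMeasure T), α / 2 * ‖P (μ t)‖ ^ 2 + 1 / 2 * ‖oneConv (fun s => D (μ s)) t‖ ^ 2
      + τ / 2 * ‖P (φ t)‖ ^ 2 ≤ energyBound T τ L * R ^ 2) ∧
    ∫ t, ‖D (φ t)‖ ^ 2 ∂(timeMeasure T)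
      ≤ dissipationBound T τ L * R ^ 2 := by
  set C := energyRate τ L with hCdef
  have hC : 0 ≤ C := by rw [hCdef, energyRate]; positivity
  have hR0 : 0 ≤ R := (norm_nonneg _).trans hp₀R
  set A := (1 + τ / 2 + T / 2) * R ^ 2 with hA
  have hA0 : 0 ≤ A := by positivity
  have hDμ : Integrable (fun s => D (μ s)) (timeMeasure T) := D.integrable_comp hμ
  have hPφt : Integrable (fun s => P (φt s)) (timeMeasure T) := P.integrable_comp hφt
  have hDφ : Integrable (fun t => ‖D (φ t)‖ ^ 2) (timeMeasure T) :=
    (D.comp_memLp' hφ).integrable_norm_pow two_ne_zero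
  have hg2 : Integrable (fun t => ‖g t‖ ^ 2) (timeMeasure T) := hg.integrable_norm_pow two_ne_zero
  set m : ℝ → H := fun t => m₀ + oneConv μt t with hm
  set p : ℝ → H := fun t => p₀ + oneConv (fun s => P (φt s)) t with hp
  -- The initial value `0` is kept so that `norm_sq_add_oneConv` applies to `q` verbatim.
  set q : ℝ → G := fun t => 0 + oneConv (fun s => D (μ s)) t with hq
  set E : ℝ → ℝ := fun t => α / 2 * ‖m t‖ ^ 2 + 1 / 2 * ‖q t‖ ^ 2 + τ / 2 * ‖p t‖ ^ 2 with hE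
  have hmc : ContinuousOn m (Icc 0 T) := continuousOn_const.add (continuousOn_oneConv hT.le hμt)
  have hpc : ContinuousOn p (Icc 0 T) := continuousOn_const.add (continuousOn_oneConv hT.le hPφt)
  have hqc : ContinuousOn q (Icc 0 T) := continuousOn_const.add (continuousOn_oneConv hT.le hDμ)
  have hEc : ContinuousOn E (Icc 0 T) :=
    ((continuousOn_const.mul (hmc.norm.pow 2)).add (continuousOn_const.mul (hqc.norm.pow 2))).add
      (continuousOn_const.mul (hpc.norm.pow 2))
  have hE0' : E 0 = α / 2 * ‖m₀‖ ^ 2 + τ / 2 * ‖p₀‖ ^ 2 := by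
    simp [hE, hm, hp, hq, oneConv]
  have hE0 : E 0 ≤ (1 / 2 + τ / 2) * R ^ 2 := by
    have h1 : α * ‖m₀‖ ^ 2 ≤ R ^ 2 := by
      have := pow_le_pow_left₀ (by positivity) hm₀R 2
      rwa [mul_pow, Real.sq_sqrt hα.le] at this
    have h2 : ‖p₀‖ ^ 2 ≤ R ^ 2 := pow_le_pow_left₀ (norm_nonneg _) hp₀R 2
    rw [hE0']
    nlinarith
  have key : ∀ t ∈ Icc 0 T, E t + ∫ s in Ioc 0 t, ‖D (φ s)‖ ^ 2 ≤ A + C * ∫ s in (0:ℝ)..t, E s := by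
    intro t ht
    have hst : Ioc 0 t ⊆ Icc 0 T := fun s hs => ⟨hs.1.le, hs.2.trans ht.2⟩
    obtain ⟨i1, e1⟩ := norm_sq_add_oneConv m₀ ht.1 (integrableOn_Ioc_of_timeMeasure ht.2 hμt)
    obtain ⟨i2, e2⟩ := norm_sq_add_oneConv p₀ ht.1 (integrableOn_Ioc_of_timeMeasure ht.2 hPφt)
    obtain ⟨i3, e3⟩ := norm_sq_add_oneConv (0 : G) ht.1 (integrableOn_Ioc_of_timeMeasure ht.2 hDμ)
    have i4 := integrableOn_Ioc_of_timeMeasure ht.2 hDφ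
    have i5 := integrableOn_Ioc_of_timeMeasure ht.2 hg2
    have i6 : IntegrableOn E (Ioc 0 t) := (hEc.integrableOn_Icc).mono_set hst
    set x : ℝ → ℝ := fun s => α * inner ℝ (μt s) (m s) + τ * inner ℝ (P (φt s)) (p s)
      + inner ℝ (D (μ s)) (q s) with hx
    have ix : IntegrableOn x (Ioc 0 t) := ((i1.const_mul α).add (i2.const_mul τ)).add i3
    have hxE : ∫ s in Ioc 0 t, x s = E t - E 0 := by
      have : ∫ s in Ioc 0 t, x s = α * (∫ s in Ioc 0 t, inner ℝ (μt s) (m s))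
          + τ * (∫ s in Ioc 0 t, inner ℝ (P (φt s)) (p s))
          + ∫ s in Ioc 0 t, inner ℝ (D (μ s)) (q s) := by
        rw [← integral_const_mul, ← integral_const_mul, ← integral_add, ← integral_add]
        · exact (i1.const_mul α).add (i2.const_mul τ)
        · exact i3
        · exact i1.const_mul α
        · exact i2.const_mul τ
      rw [this]
      change 2 * ∫ s in Ioc 0 t, inner ℝ (μt s) (m s) = ‖m t‖ ^ 2 - ‖m₀‖ ^ 2 at e1
      change 2 * ∫ s in Ioc 0 t, inner ℝ (P (φt s)) (p s) = ‖p t‖ ^ 2 - ‖p₀‖ ^ 2 at e2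
      change 2 * ∫ s in Ioc 0 t, inner ℝ (D (μ s)) (q s) = ‖q t‖ ^ 2 - ‖(0 : G)‖ ^ 2 at e3
      rw [norm_zero] at e3
      rw [hE0']
      simp only [hE]
      linear_combination α / 2 * e1 + τ / 2 * e2 + 1 / 2 * e3
    have hpt : ∀ᵐ s ∂(volume.restrict (Ioc 0 t)),
        x s + ‖D (φ s)‖ ^ 2 ≤ R ^ 2 / 2 + ‖g s‖ ^ 2 / 2 + C * E s := by
      refine ae_restrict_Ioc_of_timeMeasure ht.2 ?_
      filter_upwards [hμ_eq, hφ_eq, h₁, h₂, hr] with s a1 a2 a3 a4 a5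
      have b1 := a3 (μ s)
      have b2 := a4 (φ s)
      have c1 : P (μ s) = m s := a1
      have c2 : P (φ s) = p s := a2
      have c3 : oneConv (fun s => D (μ s)) s = q s := (zero_add _).symm
      rw [c1, c2, c3] at b1
      rw [c1, c2, real_inner_self_eq_norm_sq, inner_add_left] at b2
      rw [c2] at a5
      refine energy_integrand_le hα hτ hL hR a5 ‖q s‖ ?_
      simp only [hx]
      -- The coupling terms in `b1` and `b2` are equal up to symmetry and cancel.
      have c4 : inner ℝ (p s) (m s) = inner ℝ (m s) (p s) := real_inner_comm _ _
      have c5 : inner ℝ (q s) (D (μ s)) = inner ℝ (D (μ s)) (q s) := real_inner_comm _ _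
      linarith
    have i7 : Integrable (fun _ : ℝ => R ^ 2 / 2) (volume.restrict (Ioc 0 t)) :=
      integrable_const _
    have i8 : Integrable (fun s => R ^ 2 / 2 + ‖g s‖ ^ 2 / 2) (volume.restrict (Ioc 0 t)) :=
      i7.add (i5.div_const 2)
    have hint := integral_mono_ae (ix.add i4)
      (i8.add (i6.const_mul C)) hpt
    simp only [Pi.add_apply] at hint
    rw [integral_add ix i4, integral_add i8 (i6.const_mul C),
      integral_add i7 (i5.div_const 2), hxE, integral_const_mul,
      setIntegral_const, integral_div] at hint
    have hgt : ∫ s in Ioc 0 t, ‖g s‖ ^ 2 ≤ R ^ 2 := by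
      refine le_trans ?_ hgR
      rw [integral_timeMeasure_eq]
      exact setIntegral_mono_set (integrableOn_Ioc_of_timeMeasure le_rfl hg2)
        (Filter.Eventually.of_forall fun s => by positivity)
        (Ioc_subset_Ioc_right ht.2).eventuallyLE
    rw [intervalIntegral.integral_of_le ht.1]
    simp only [Real.volume_real_Ioc_of_le ht.1, sub_zero, smul_eq_mul] at hint
    have : t * (R ^ 2 / 2) ≤ T * (R ^ 2 / 2) := by gcongr; exact ht.2
    rw [hA]
    linarith
  have hGr : ∀ t ∈ Icc 0 T, E t ≤ energyBound T τ L * R ^ 2 := by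
    intro t ht
    have h := gronwall_integral (A := A) hC hEc (fun t ht => ?_) t ht
    · refine h.trans ?_
      rw [hA, energyBound, ← hCdef, mul_right_comm]
      gcongr
      exact ht.2
    · have h0 : 0 ≤ ∫ s in Ioc 0 t, ‖D (φ s)‖ ^ 2 := integral_nonneg fun s => by positivity
      linarith [key t ht]
  constructor
  · filter_upwards [hμ_eq, hφ_eq, ae_restrict_mem measurableSet_Ioo] with t a1 a2 ht
    have := hGr t (Ioo_subset_Icc_self ht)
    simp only [hE, hm, hp, hq, zero_add] at this
    rwa [a1, a2]
  · have h := key T (right_mem_Icc.2 hT.le)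
    have hET : 0 ≤ E T := by positivity
    have hIE : ∫ s in (0 : ℝ)..T, E s ≤ T * (energyBound T τ L * R ^ 2) := by
      have := intervalIntegral.integral_mono_on (μ := volume) hT.le
        (g := fun _ => energyBound T τ L * R ^ 2)
        (ContinuousOn.intervalIntegrable (by rwa [uIcc_of_le hT.le]))
        intervalIntegrable_const hGr
      rwa [intervalIntegral.integral_const, sub_zero, smul_eq_mul] at this
    rw [integral_timeMeasure_eq]
    have := mul_le_mul_of_nonneg_left hIE hC
    rw [hA] at h
    rw [dissipationBound, ← hCdef]
    linarith

end Energy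

/-! ### Subdifferentials and the spaces `H`, `V`, `W` -/

theorem subdiff_ne_top {f : ℝ → ℝ≥0∞} (h0 : f 0 = 0) {r s : ℝ} (h : s ∈ subdiff f r) :
    f r ≠ ⊤ := by
  intro hr
  have := h 0
  rw [hr, h0, EReal.coe_ennreal_top, EReal.top_add_coe, EReal.coe_ennreal_zero] at this
  exact absurd this (by simp)

/-- The subdifferential is monotone. Since `f 0 = 0`, the function `f` is finite where the
subdifferential is nonempty. -/
theorem subdiff_monotone {f : ℝ → ℝ≥0∞} (h0 : f 0 = 0) {r₁ r₂ s₁ s₂ : ℝ}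
    (h₁ : s₁ ∈ subdiff f r₁) (h₂ : s₂ ∈ subdiff f r₂) : 0 ≤ (s₁ - s₂) * (r₁ - r₂) := by
  have a := h₁ r₂
  have b := h₂ r₁
  lift f r₁ to ℝ≥0 using subdiff_ne_top h0 h₁ with x hx
  lift f r₂ to ℝ≥0 using subdiff_ne_top h0 h₂ with y hy
  change ((x : ℝ) : EReal) + _ ≤ ((y : ℝ) : EReal) at a
  change ((y : ℝ) : EReal) + _ ≤ ((x : ℝ) : EReal) at b
  norm_cast at a b
  linarith

section Space

variable {N : ℕ} {Ω : Set (EuclideanSpace ℝ (Fin N))}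

theorem IsSmoothDomain.isFiniteMeasure (hΩ : IsSmoothDomain Ω) :
    IsFiniteMeasure (volume.restrict Ω) :=
  isFiniteMeasure_restrict.2 hΩ.isBounded.measure_lt_top.ne

theorem ae_eq_of_forall_isTest (hΩ : IsSmoothDomain Ω) {u v : EuclideanSpace ℝ (Fin N) → ℝ}
    (hu : MemLp u 2 (volume.restrict Ω)) (hv : MemLp v 2 (volume.restrict Ω))
    (h : ∀ ψ, IsTest Ω ψ → ∫ x in Ω, u x * ψ x = ∫ x in Ω, v x * ψ x) :
    u =ᵐ[volume.restrict Ω] v := by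
  have := hΩ.isFiniteMeasure
  have hw : IntegrableOn (fun x => u x - v x) Ω := (hu.sub hv).integrable one_le_two
  have key : ∀ᵐ x ∂(volume.restrict Ω), u x - v x = 0 := by
    rw [ae_restrict_iff' hΩ.isOpen.measurableSet]
    refine hΩ.isOpen.ae_eq_zero_of_integral_contDiff_smul_eq_zero hw.locallyIntegrableOn
      fun ψ h1 h2 h3 => ?_
    have hψ : IsTest Ω ψ := ⟨h1, h2, h3⟩
    have h4 : ∫ x in Ω, ψ x • (u x - v x) = 0 := by
      have e : (fun x => ψ x • (u x - v x)) = fun x => u x * ψ x - v x * ψ x := by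
        ext x; simp only [smul_eq_mul]; ring
      have hu' : Integrable (fun x => u x * ψ x) (volume.restrict Ω) := hu.integrable_mul hψ.memLp
      have hv' : Integrable (fun x => v x * ψ x) (volume.restrict Ω) := hv.integrable_mul hψ.memLp
      rw [e, integral_sub hu' hv', h ψ hψ, sub_self]
    rw [← h4]
    refine (setIntegral_eq_integral_of_forall_compl_eq_zero fun x hx => ?_).symm
    rw [image_eq_zero_of_notMem_tsupport fun h' => hx (h3 h'), zero_smul]
  filter_upwards [key] with x hx using sub_eq_zero.1 hx

theorem memLp_coord {ι : Type} [Fintype ι] (G : L2 Ω (EuclideanSpace ℝ ι)) (i : ι) :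
    MemLp (fun x => G x i) 2 (volume.restrict Ω) :=
  (coord i).comp_memLp' (Lp.memLp G)

theorem L2_ext_coord {ι : Type} [Fintype ι] {G G' : L2 Ω (EuclideanSpace ℝ ι)}
    (h : ∀ i, (fun x => G x i) =ᵐ[volume.restrict Ω] fun x => G' x i) : G = G' := by
  refine Lp.ext ?_
  filter_upwards [ae_all_iff.2 h] with x hx
  ext i
  exact hx i

theorem toH_injective (hΩ : IsSmoothDomain Ω) : Function.Injective (toH Ω) := by
  intro u v huv
  have h1 : (u : WithLp 2 (H Ω × HVec Ω)).fst = (v : WithLp 2 (H Ω × HVec Ω)).fst := huv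
  have h2 : (u : WithLp 2 (H Ω × HVec Ω)).snd = (v : WithLp 2 (H Ω × HVec Ω)).snd := by
    refine L2_ext_coord fun i => ae_eq_of_forall_isTest hΩ (memLp_coord _ i) (memLp_coord _ i)
      fun ψ hψ => ?_
    have a := u.2 ψ hψ i
    have b := v.2 ψ hψ i
    rw [h1] at a
    linarith
  refine Subtype.ext ((WithLp.equiv 2 _).injective (Prod.ext h1 h2))

theorem toV_injective (hΩ : IsSmoothDomain Ω) : Function.Injective (toV Ω) := by
  intro u v huv
  have h1 : (u : WithLp 2 (V Ω × HMat Ω)).fst = (v : WithLp 2 (V Ω × HMat Ω)).fst := huv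
  have h2 : (u : WithLp 2 (V Ω × HMat Ω)).snd = (v : WithLp 2 (V Ω × HMat Ω)).snd := by
    refine L2_ext_coord fun ij => ae_eq_of_forall_isTest hΩ (memLp_coord _ ij) (memLp_coord _ ij)
      fun ψ hψ => ?_
    have a := u.2.1 ψ hψ ij.1 ij.2
    have b := v.2.1 ψ hψ ij.1 ij.2
    rw [h1] at a
    linarith
  refine Subtype.ext ((WithLp.equiv 2 _).injective (Prod.ext h1 h2))

theorem norm_sq_eq_toH_add_grad (v : V Ω) : ‖v‖ ^ 2 = ‖toH Ω v‖ ^ 2 + ‖grad Ω v‖ ^ 2 :=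
  WithLp.prod_norm_sq_eq_of_L2 (v : WithLp 2 (H Ω × HVec Ω))

/-- Test functions belong to `V`. -/
theorem IsTest.exists_toH_eq {ψ : EuclideanSpace ℝ (Fin N) → ℝ} (hψ : IsTest Ω ψ) :
    ∃ v : V Ω, toH Ω v =ᵐ[volume.restrict Ω] ψ := by
  have hG : MemLp (fun x => WithLp.toLp 2 fun i => partialDeriv i ψ x) 2 (volume.restrict Ω) := by
    refine Continuous.memLp_of_hasCompactSupport ?_ ?_
    · refine (PiLp.continuous_toLp 2 _).comp (continuous_pi fun i => ?_)
      exact (hψ.smooth.continuous_fderiv (by simp)).clm_apply continuous_const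
    · have h := HasCompactSupport.fderiv (𝕜 := ℝ) hψ.compact
      refine h.mono' fun x hx => ?_
      refine subset_tsupport _ fun h0 => hx ?_
      ext i
      simp [partialDeriv, h0]
  refine ⟨⟨WithLp.toLp 2 (hψ.memLp.toLp ψ, hG.toLp _), fun χ hχ i => ?_⟩, hψ.memLp.coeFn_toLp⟩
  have e1 : ∫ x in Ω, hψ.memLp.toLp ψ x * partialDeriv i χ x = ∫ x, ψ x * partialDeriv i χ x := by
    rw [← setIntegral_eq_integral_of_forall_compl_eq_zero (s := Ω)
      (f := fun x => ψ x * partialDeriv i χ x)]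
    · refine integral_congr_ae ?_
      filter_upwards [hψ.memLp.coeFn_toLp] with x hx
      rw [hx]
    · intro x hx
      rw [image_eq_zero_of_notMem_tsupport fun h' => hx (hψ.support h'), zero_mul]
  have e2 : ∫ x in Ω, hG.toLp _ x i * χ x = ∫ x, partialDeriv i ψ x * χ x := by
    rw [← setIntegral_eq_integral_of_forall_compl_eq_zero (s := Ω)
      (f := fun x => partialDeriv i ψ x * χ x)]
    · refine integral_congr_ae ?_
      filter_upwards [hG.coeFn_toLp] with x hx
      rw [hx]
    · intro x hx
      rw [image_eq_zero_of_notMem_tsupport fun h' => hx (hχ.support h'), mul_zero]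
  change ∫ x in Ω, hψ.memLp.toLp ψ x * partialDeriv i χ x = - ∫ x in Ω, hG.toLp _ x i * χ x
  rw [e1, e2]
  have hdc : ∀ {χ : EuclideanSpace ℝ (Fin N) → ℝ}, IsTest Ω χ →
      Continuous fun x => fderiv ℝ χ x (EuclideanSpace.single i 1) := fun hχ =>
    (hχ.smooth.continuous_fderiv (by simp)).clm_apply continuous_const
  refine integral_mul_fderiv_eq_neg_fderiv_mul_of_integrable ?_ ?_ ?_
    (fun _ _ => (hψ.smooth.differentiable (by simp)).differentiableAt)
    (fun _ _ => (hχ.smooth.differentiable (by simp)).differentiableAt)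
  · exact ((hdc hψ).mul hχ.smooth.continuous).integrable_of_hasCompactSupport hχ.compact.mul_left
  · exact (hψ.smooth.continuous.mul (hdc hχ)).integrable_of_hasCompactSupport hψ.compact.mul_right
  · exact (hψ.smooth.continuous.mul hχ.smooth.continuous).integrable_of_hasCompactSupport
      hψ.compact.mul_right

/-- `V` is dense in `H`, in the form used here: elements of `H` are separated by `V`. -/
theorem eq_of_forall_inner_toH (hΩ : IsSmoothDomain Ω) {u v : H Ω}
    (h : ∀ w : V Ω, inner ℝ u (toH Ω w) = inner ℝ v (toH Ω w)) : u = v := by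
  refine Lp.ext (ae_eq_of_forall_isTest hΩ (Lp.memLp u) (Lp.memLp v) fun ψ hψ => ?_)
  obtain ⟨w, hw⟩ := hψ.exists_toH_eq
  have key : ∀ u : H Ω, inner ℝ u (toH Ω w) = ∫ x in Ω, u x * ψ x := by
    intro u
    rw [L2.inner_def]
    refine integral_congr_ae ?_
    filter_upwards [hw] with x hx
    rw [hx]
    simp [mul_comm]
  rw [← key, ← key, h w]

theorem memLp_comp_lipschitz (hΩ : IsSmoothDomain Ω) {F : ℝ → ℝ} {L : ℝ≥0} (hF : LipschitzWith L F)
    (u : H Ω) : MemLp (fun x => F (u x)) 2 (volume.restrict Ω) := by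
  have := hΩ.isFiniteMeasure
  have h1 : LipschitzWith L fun r => F r - F 0 := by
    intro x y
    simpa [edist_sub_right] using hF x y
  have h2 := (h1.comp_memLp (by simp) (Lp.memLp u)).add (memLp_const (F 0))
  refine h2.ae_eq (Filter.Eventually.of_forall fun x => ?_)
  simp

/-- Monotonicity of `∂f` up to the Lipschitz perturbation `F`. -/
theorem neg_mul_le_inner_sub (hΩ : IsSmoothDomain Ω) {F : ℝ → ℝ} {L : ℝ≥0}
    (hF : LipschitzWith L F) {f : ℝ → ℝ≥0∞} (h0 : f 0 = 0) {u₁ u₂ ξ₁ ξ₂ : H Ω}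
    (h₁ : ∀ᵐ x ∂(volume.restrict Ω), ξ₁ x ∈ subdiff f (u₁ x))
    (h₂ : ∀ᵐ x ∂(volume.restrict Ω), ξ₂ x ∈ subdiff f (u₂ x)) :
    -(L * ‖u₁ - u₂‖ ^ 2) ≤ inner ℝ (ξ₁ + (memLp_comp_lipschitz hΩ hF u₁).toLp _
      - (ξ₂ + (memLp_comp_lipschitz hΩ hF u₂).toLp _)) (u₁ - u₂) := by
  set F₁ := (memLp_comp_lipschitz hΩ hF u₁).toLp _ with hF₁
  set F₂ := (memLp_comp_lipschitz hΩ hF u₂).toLp _ with hF₂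
  have a : 0 ≤ inner ℝ (ξ₁ - ξ₂) (u₁ - u₂) := by
    rw [L2.inner_def]
    refine integral_nonneg_of_ae ?_
    filter_upwards [h₁, h₂, Lp.coeFn_sub ξ₁ ξ₂, Lp.coeFn_sub u₁ u₂] with x b1 b2 b3 b4
    rw [b3, b4]
    have := subdiff_monotone h0 b1 b2
    simpa [mul_comm] using this
  have b : ‖F₁ - F₂‖ ≤ L * ‖u₁ - u₂‖ := by
    refine Lp.norm_le_mul_norm_of_ae_le_mul ?_
    filter_upwards [Lp.coeFn_sub F₁ F₂, Lp.coeFn_sub u₁ u₂,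
      (memLp_comp_lipschitz hΩ hF u₁).coeFn_toLp,
      (memLp_comp_lipschitz hΩ hF u₂).coeFn_toLp] with x b1 b2 b3 b4
    rw [b1, b2, Pi.sub_apply, Pi.sub_apply, hF₁, hF₂, b3, b4]
    exact hF.norm_sub_le _ _
  have c := neg_le_of_abs_le (abs_real_inner_le_norm (F₁ - F₂) (u₁ - u₂))
  have d : ‖F₁ - F₂‖ * ‖u₁ - u₂‖ ≤ L * ‖u₁ - u₂‖ * ‖u₁ - u₂‖ := by gcongr
  have e : ξ₁ + F₁ - (ξ₂ + F₂) = (ξ₁ - ξ₂) + (F₁ - F₂) := by abel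
  rw [e, inner_add_left]
  nlinarith

end Space

/-! ### Integrated equations and differences of solutions -/

/-- The primitive representation in `V*`, evaluated at `v ∈ V`. The exceptional null set does not
depend on `v`. -/
theorem inner_eq_add_integral_of_hasWeakTimeDeriv_dual {V H : Type*} [NormedAddCommGroup V]
    [NormedSpace ℝ V] [NormedAddCommGroup H] [InnerProductSpace ℝ H] (P : V →L[ℝ] H) {T : ℝ}
    (hT : 0 < T) {u : ℝ → H} {w : ℝ → V →L[ℝ] ℝ} {x : H} (hu : Integrable u (timeMeasure T))
    (hw : MemLp w ∞ (timeMeasure T))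
    (hd : HasWeakTimeDeriv T (fun t => (innerSL ℝ (u t)).comp P) w)
    (h0 : HasInitialValue T (fun t => (innerSL ℝ (u t)).comp P) ((innerSL ℝ x).comp P)) :
    ∀ᵐ t ∂(timeMeasure T), ∀ v : V, IntegrableOn (fun r => w r v) (Ioc 0 t) ∧
      inner ℝ (u t) (P v) = inner ℝ x (P v) + ∫ r in Ioc 0 t, w r v := by
  have iw : Integrable w (timeMeasure T) := hw.integrable le_top
  have iu : Integrable (fun t => (innerSL ℝ (u t)).comp P) (timeMeasure T) :=
    (((ContinuousLinearMap.compL ℝ V H ℝ).flip P).integrable_comp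
      ((innerSL ℝ : H →L[ℝ] H →L[ℝ] ℝ).integrable_comp hu))
  filter_upwards [hd.ae_eq_add_oneConv hT iu iw h0, ae_restrict_mem measurableSet_Ioo]
    with t h ht v
  have i := integrableOn_Ioc_of_timeMeasure ht.2.le iw
  refine ⟨(ContinuousLinearMap.apply ℝ ℝ v).integrable_comp i, ?_⟩
  have := congrArg (fun l : V →L[ℝ] ℝ => l v) h
  simp only [add_apply, ContinuousLinearMap.comp_apply,
    innerSL_apply_apply] at this
  rw [this, oneConv_eq_setIntegral _ ht.1.le, ContinuousLinearMap.integral_apply i]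

/-- The first equation integrated in time. -/
theorem integrated_equation {V H G : Type*} [NormedAddCommGroup V] [NormedSpace ℝ V]
    [CompleteSpace V] [NormedAddCommGroup H] [InnerProductSpace ℝ H] [CompleteSpace H]
    [NormedAddCommGroup G] [InnerProductSpace ℝ G] [CompleteSpace G] (P : V →L[ℝ] H)
    (D : V →L[ℝ] G) {T α : ℝ} (hT : 0 < T) {μt p : ℝ → H} {μtt : ℝ → V →L[ℝ] ℝ} {μ φt : ℝ → V}
    {n₀ p₀ : H} (hμ : Integrable μ (timeMeasure T)) (hφt : Integrable φt (timeMeasure T))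
    (hμt : Integrable μt (timeMeasure T)) (hμtt : MemLp μtt ∞ (timeMeasure T))
    (hd : HasWeakTimeDeriv T (fun t => (innerSL ℝ (μt t)).comp P) μtt)
    (h0 : HasInitialValue T (fun t => (innerSL ℝ (μt t)).comp P) ((innerSL ℝ n₀).comp P))
    (hp : ∀ᵐ t ∂(timeMeasure T), p t = p₀ + oneConv (fun r => P (φt r)) t)
    (heq : ∀ᵐ t ∂(timeMeasure T), ∀ v : V, α * μtt t v + inner ℝ (P (φt t)) (P v)
      + inner ℝ (D (μ t)) (D v) = 0) :
    ∀ᵐ t ∂(timeMeasure T), ∀ v : V, α * inner ℝ (μt t) (P v) + inner ℝ (p t) (P v)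
      + inner ℝ (oneConv (fun r => D (μ r)) t) (D v) = inner ℝ (α • n₀ + p₀) (P v) := by
  filter_upwards [inner_eq_add_integral_of_hasWeakTimeDeriv_dual P hT hμt hμtt hd h0, hp,
    ae_restrict_mem measurableSet_Ioo] with t h1 h2 ht v
  have i2 := integrableOn_Ioc_of_timeMeasure ht.2.le (P.integrable_comp hφt)
  have i3 := integrableOn_Ioc_of_timeMeasure ht.2.le (D.integrable_comp hμ)
  obtain ⟨i1, e1⟩ := h1 v
  have e2 : inner ℝ (oneConv (fun r => P (φt r)) t) (P v)
      = ∫ r in Ioc 0 t, inner ℝ (P (φt r)) (P v) := by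
    rw [real_inner_comm, oneConv_eq_setIntegral _ ht.1.le, ← integral_inner i2]
    exact integral_congr_ae (Filter.Eventually.of_forall fun r => real_inner_comm _ _)
  have e3 : inner ℝ (oneConv (fun r => D (μ r)) t) (D v)
      = ∫ r in Ioc 0 t, inner ℝ (D (μ r)) (D v) := by
    rw [real_inner_comm, oneConv_eq_setIntegral _ ht.1.le, ← integral_inner i3]
    exact integral_congr_ae (Filter.Eventually.of_forall fun r => real_inner_comm _ _)
  have j1 : IntegrableOn (fun r => α * μtt r v) (Ioc 0 t) := i1.const_mul α
  have j2 : IntegrableOn (fun r => inner ℝ (P (φt r)) (P v)) (Ioc 0 t) := i2.inner_const _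
  have j3 : IntegrableOn (fun r => inner ℝ (D (μ r)) (D v)) (Ioc 0 t) := i3.inner_const _
  have j12 : IntegrableOn (fun r => α * μtt r v + inner ℝ (P (φt r)) (P v)) (Ioc 0 t) := j1.add j2
  have e4 : ∫ r in Ioc 0 t, (α * μtt r v + inner ℝ (P (φt r)) (P v)
      + inner ℝ (D (μ r)) (D v)) = 0 := by
    refine integral_eq_zero_of_ae (ae_restrict_Ioc_of_timeMeasure ht.2.le ?_)
    filter_upwards [heq] with r hr using hr v
  rw [integral_add j12 j3, integral_add j1 j2, integral_const_mul] at e4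
  rw [e1, h2, inner_add_left, e2, e3, inner_add_left, real_inner_smul_left]
  linarith

theorem memLp_two_clm_comp {X Y : Type*} [NormedAddCommGroup X] [NormedSpace ℝ X]
    [NormedAddCommGroup Y] [NormedSpace ℝ Y] (l : X →L[ℝ] Y) {T : ℝ} {u : ℝ → X}
    (hu : MemLp u ∞ (timeMeasure T)) : MemLp (fun t => l (u t)) 2 (timeMeasure T) :=
  (l.comp_memLp' hu).mono_exponent le_top

section Solutions

variable {N : ℕ} {Ω : Set (EuclideanSpace ℝ (Fin N))}

theorem inner_toLp_eq_integral {u : EuclideanSpace ℝ (Fin N) → ℝ}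
    (hu : MemLp u 2 (volume.restrict Ω)) (w : H Ω) :
    inner ℝ (hu.toLp u) w = ∫ x in Ω, u x * w x := by
  rw [L2.inner_def]
  refine integral_congr_ae ?_
  filter_upwards [hu.coeFn_toLp] with x hx
  rw [hx]
  simp [mul_comm]

theorem toH_sub (u v : V Ω) : toH Ω (u - v) = toH Ω u - toH Ω v := map_sub (toH Ω) u v

theorem grad_sub (u v : V Ω) : grad Ω (u - v) = grad Ω u - grad Ω v := map_sub (grad Ω) u v

theorem toV_sub (u v : W Ω) : toV Ω (u - v) = toV Ω u - toV Ω v := map_sub (toV Ω) u v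

namespace IsSolutionWith

variable {T α τ : ℝ} {f₁ : ℝ → ℝ≥0∞} {f₂ : ℝ → ℝ} {d : Data Ω} {μ : ℝ → V Ω} {φ : ℝ → W Ω}
  {ξ : ℝ → H Ω} {μt : ℝ → H Ω} {μtt : ℝ → VDual Ω} {φt : ℝ → V Ω}

theorem integrable_μ (s : IsSolutionWith T α τ f₁ f₂ d μ φ ξ μt μtt φt) :
    Integrable μ (timeMeasure T) := s.μ_mem.integrable le_top

theorem integrable_μt (s : IsSolutionWith T α τ f₁ f₂ d μ φ ξ μt μtt φt) :
    Integrable μt (timeMeasure T) := s.μt_mem.integrable le_top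

theorem integrable_φt (s : IsSolutionWith T α τ f₁ f₂ d μ φ ξ μt μtt φt) :
    Integrable φt (timeMeasure T) := s.φt_mem.integrable one_le_two

theorem memLp_toV_φ (s : IsSolutionWith T α τ f₁ f₂ d μ φ ξ μt μtt φt) :
    MemLp (fun t => toV Ω (φ t)) 2 (timeMeasure T) :=
  @memLp_two_clm_comp (W Ω) (V Ω) _ (Submodule.normedSpace _) _ _ (toV Ω) _ _ s.φ_mem

theorem toH_μ_eq (hT : 0 < T) (s : IsSolutionWith T α τ f₁ f₂ d μ φ ξ μt μtt φt) :
    ∀ᵐ t ∂(timeMeasure T), toH Ω (μ t) = toH Ω d.μ₀ + oneConv μt t :=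
  s.μt_deriv.ae_eq_add_oneConv hT ((toH Ω).integrable_comp s.integrable_μ) s.integrable_μt s.init_μ

theorem toH_φ_eq (hT : 0 < T) (s : IsSolutionWith T α τ f₁ f₂ d μ φ ξ μt μtt φt) :
    ∀ᵐ t ∂(timeMeasure T), toH Ω (toV Ω (φ t))
      = toH Ω (toV Ω d.φ₀) + oneConv (fun r => toH Ω (φt r)) t := by
  have h := s.memLp_toV_φ.integrable one_le_two
  exact (s.φt_deriv.clm_comp (toH Ω) h s.integrable_φt).ae_eq_add_oneConv hT
    ((toH Ω).integrable_comp h) ((toH Ω).integrable_comp s.integrable_φt) s.init_φ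

theorem eq_first_integrated (hT : 0 < T) (s : IsSolutionWith T α τ f₁ f₂ d μ φ ξ μt μtt φt) :
    ∀ᵐ t ∂(timeMeasure T), ∀ v : V Ω,
      α * inner ℝ (μt t) (toH Ω v) + inner ℝ (toH Ω (toV Ω (φ t))) (toH Ω v)
        + inner ℝ (oneConv (fun r => grad Ω (μ r)) t) (grad Ω v)
      = inner ℝ (α • d.ν₀ + toH Ω (toV Ω d.φ₀)) (toH Ω v) :=
  integrated_equation (toH Ω) (grad Ω) hT s.integrable_μ s.integrable_φt s.integrable_μt
    s.μtt_mem s.μtt_deriv s.init_μt (s.toH_φ_eq hT) s.eq_first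

theorem eq_second_toLp (hΩ : IsSmoothDomain Ω) {L : ℝ≥0} (hL : LipschitzWith L (deriv f₂))
    (s : IsSolutionWith T α τ f₁ f₂ d μ φ ξ μt μtt φt) :
    ∀ᵐ t ∂(timeMeasure T), ∀ v : V Ω,
      τ * inner ℝ (toH Ω (φt t)) (toH Ω v) + inner ℝ (grad Ω (toV Ω (φ t))) (grad Ω v)
        + inner ℝ (ξ t + (memLp_comp_lipschitz hΩ hL (toH Ω (toV Ω (φ t)))).toLp _) (toH Ω v)
      = inner ℝ (toH Ω (μ t) + d.g t) (toH Ω v) := by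
  filter_upwards [s.eq_second] with t ht v
  rw [← ht v, inner_add_left, inner_toLp_eq_integral]

variable {d' : Data Ω} {μ' : ℝ → V Ω} {φ' : ℝ → W Ω}
  {ξ' : ℝ → H Ω} {μt' : ℝ → H Ω} {μtt' : ℝ → VDual Ω} {φt' : ℝ → V Ω}

set_option maxHeartbeats 1000000 in
/-- The energy estimate for the difference of two solutions. -/
theorem energy_estimate_sub (hΩ : IsSmoothDomain Ω) (hT : 0 < T) (hα : 0 < α) (hτ : 0 < τ)
    {L : ℝ≥0} (hf : IsPotential f₁ f₂ L)
    (s : IsSolutionWith T α τ f₁ f₂ d μ φ ξ μt μtt φt)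
    (s' : IsSolutionWith T α τ f₁ f₂ d' μ' φ' ξ' μt' μtt' φt')
    (hg : MemLp d.g 2 (timeMeasure T)) (hg' : MemLp d'.g 2 (timeMeasure T)) {R : ℝ}
    (hμR : √α * ‖toH Ω (d.μ₀ - d'.μ₀)‖ ≤ R) (hφR : ‖toH Ω (toV Ω (d.φ₀ - d'.φ₀))‖ ≤ R)
    (hR : √α * ‖d.ν₀ - d'.ν₀‖ + ‖toH Ω (toV Ω (d.φ₀ - d'.φ₀))‖ / √α ≤ R)
    (hgR : ∫ t, ‖d.g t - d'.g t‖ ^ 2 ∂(timeMeasure T) ≤ R ^ 2) :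
    (∀ᵐ t ∂(timeMeasure T), α / 2 * ‖toH Ω (μ t - μ' t)‖ ^ 2
      + 1 / 2 * ‖grad Ω (oneConv (fun r => μ r - μ' r) t)‖ ^ 2
      + τ / 2 * ‖toH Ω (toV Ω (φ t - φ' t))‖ ^ 2 ≤ energyBound T τ L * R ^ 2) ∧
    ∫ t, ‖grad Ω (toV Ω (φ t - φ' t))‖ ^ 2 ∂(timeMeasure T)
      ≤ dissipationBound T τ L * R ^ 2 := by
  have iμ : Integrable (fun t => μ t - μ' t) (timeMeasure T) := s.integrable_μ.sub s'.integrable_μ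
  have iφ : MemLp (fun t => toV Ω (φ t - φ' t)) 2 (timeMeasure T) := by
    simp only [toV_sub]
    exact s.memLp_toV_φ.sub s'.memLp_toV_φ
  have iPφ := (toH Ω).integrable_comp s.integrable_φt
  have iPφ' := (toH Ω).integrable_comp s'.integrable_φt
  have iDμ := (grad Ω).integrable_comp s.integrable_μ
  have iDμ' := (grad Ω).integrable_comp s'.integrable_μ
  have key := energy_estimate (toH Ω) (grad Ω) (L := L) (R := R) hT hα hτ L.2 iμ iφ
    (s.integrable_μt.sub s'.integrable_μt) (s.integrable_φt.sub s'.integrable_φt) (hg.sub hg')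
    (r := fun t => ξ t + (memLp_comp_lipschitz hΩ hf.lipschitz (toH Ω (toV Ω (φ t)))).toLp _
      - (ξ' t + (memLp_comp_lipschitz hΩ hf.lipschitz (toH Ω (toV Ω (φ' t)))).toLp _))
    (m₀ := toH Ω (d.μ₀ - d'.μ₀)) (n₀ := d.ν₀ - d'.ν₀) (p₀ := toH Ω (toV Ω (d.φ₀ - d'.φ₀)))
    ?_ ?_ ?_ ?_ ?_ hμR hφR hR hgR
  · refine ⟨?_, key.2⟩
    filter_upwards [key.1, ae_restrict_mem measurableSet_Ioo] with t h ht
    rwa [clm_oneConv (grad Ω) iμ ht]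
  · filter_upwards [s.toH_μ_eq hT, s'.toH_μ_eq hT, ae_restrict_mem measurableSet_Ioo]
      with t h h' ht
    have := oneConv_sub s.integrable_μt s'.integrable_μt ht
    simp only [Pi.sub_def]
    rw [this, toH_sub, toH_sub, h, h']
    abel
  · filter_upwards [s.toH_φ_eq hT, s'.toH_φ_eq hT, ae_restrict_mem measurableSet_Ioo]
      with t h h' ht
    have := oneConv_sub iPφ iPφ' ht
    simp only [Pi.sub_def, toH_sub, toV_sub]
    rw [this, h, h']
    abel
  · filter_upwards [s.eq_first_integrated hT, s'.eq_first_integrated hT,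
      ae_restrict_mem measurableSet_Ioo] with t h h' ht v
    have := oneConv_sub iDμ iDμ' ht
    have a := h v
    have a' := h' v
    simp only [Pi.sub_def, toH_sub, toV_sub, grad_sub, smul_sub, inner_add_left,
      inner_sub_left] at a a' ⊢
    rw [this, inner_sub_left]
    linarith
  · filter_upwards [s.eq_second_toLp hΩ hf.lipschitz, s'.eq_second_toLp hΩ hf.lipschitz]
      with t h h' v
    have a := h v
    have a' := h' v
    simp only [Pi.sub_def, toH_sub, toV_sub, grad_sub, inner_add_left, inner_sub_left] at a a' ⊢
    linarith
  · filter_upwards [s.inclusion, s'.inclusion] with t h h'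
    have := neg_mul_le_inner_sub hΩ hf.lipschitz hf.zero h h'
    simpa only [toH_sub, toV_sub] using this

/-- Uniqueness: `R = 0` is admissible in the energy estimate. -/
theorem ae_eq_of_same_data (hΩ : IsSmoothDomain Ω) (hT : 0 < T) (hα : 0 < α) (hτ : 0 < τ)
    {L : ℝ≥0} (hf : IsPotential f₁ f₂ L) (hg : MemLp d.g 2 (timeMeasure T))
    (s : IsSolutionWith T α τ f₁ f₂ d μ φ ξ μt μtt φt)
    (s' : IsSolutionWith T α τ f₁ f₂ d μ' φ' ξ' μt' μtt' φt') :
    μ =ᵐ[timeMeasure T] μ' ∧ φ =ᵐ[timeMeasure T] φ' ∧ ξ =ᵐ[timeMeasure T] ξ' := by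
  have key := (energy_estimate_sub hΩ hT hα hτ hf s s' hg hg (R := 0) (by simp) (by simp)
    (by simp) (by simp)).1
  have hμ : μ =ᵐ[timeMeasure T] μ' := by
    filter_upwards [key] with t ht
    refine toH_injective hΩ (sub_eq_zero.1 ?_)
    rw [← toH_sub, ← norm_eq_zero, ← sq_eq_zero_iff]
    have h1 : 0 ≤ 1 / 2 * ‖grad Ω (oneConv (fun r => μ r - μ' r) t)‖ ^ 2
      + τ / 2 * ‖toH Ω (toV Ω (φ t - φ' t))‖ ^ 2 := by positivity
    refine le_antisymm (le_of_mul_le_mul_left ?_ (half_pos hα)) (by positivity)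
    rw [mul_zero]
    linarith
  have hφ : φ =ᵐ[timeMeasure T] φ' := by
    filter_upwards [key] with t ht
    refine toV_injective hΩ (toH_injective hΩ (sub_eq_zero.1 ?_))
    rw [← toH_sub, ← toV_sub, ← norm_eq_zero, ← sq_eq_zero_iff]
    have h1 : 0 ≤ α / 2 * ‖toH Ω (μ t - μ' t)‖ ^ 2
      + 1 / 2 * ‖grad Ω (oneConv (fun r => μ r - μ' r) t)‖ ^ 2 := by positivity
    refine le_antisymm (le_of_mul_le_mul_left ?_ (half_pos hτ)) (by positivity)
    rw [mul_zero]
    linarith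
  have hφt : φt =ᵐ[timeMeasure T] φt' := by
    refine s.φt_deriv.ae_eq s.integrable_φt s'.integrable_φt s'.φt_deriv ?_
    filter_upwards [hφ] with t ht
    rw [ht]
  refine ⟨hμ, hφ, ?_⟩
  filter_upwards [hμ, hφ, hφt, s.eq_second, s'.eq_second] with t h1 h2 h3 h4 h5
  refine eq_of_forall_inner_toH hΩ fun w => ?_
  have a := h4 w
  have b := h5 w
  rw [h1, h2, h3] at a
  linarith

end IsSolutionWith

end Solutions

/-! ### The estimate in Bochner norms -/

theorem eLpNorm_two_eq {X : Type*} [NormedAddCommGroup X] {T : ℝ} {u : ℝ → X}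
    (hu : MemLp u 2 (timeMeasure T)) :
    eLpNorm u 2 (timeMeasure T) = ENNReal.ofReal √(∫ t, ‖u t‖ ^ 2 ∂(timeMeasure T)) := by
  rw [hu.eLpNorm_eq_integral_rpow_norm two_ne_zero ENNReal.ofNat_ne_top, Real.sqrt_eq_rpow]
  simp

theorem eLpNorm_top_le_of_sq_le {X : Type*} [NormedAddCommGroup X] {T c B : ℝ} (hc : 0 < c)
    {u : ℝ → X} (h : ∀ᵐ t ∂(timeMeasure T), c * ‖u t‖ ^ 2 ≤ B) :
    eLpNorm u ∞ (timeMeasure T) ≤ ENNReal.ofReal √(B / c) := by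
  rw [eLpNorm_exponent_top]
  refine eLpNormEssSup_le_of_ae_bound ?_
  filter_upwards [h] with t ht
  refine Real.le_sqrt_of_sq_le ?_
  rw [le_div_iff₀ hc]
  linarith

/-- The constant `K₂` of the stability estimate. -/
noncomputable def stabilityConst (T τ L : ℝ) : ℝ :=
  1 + (2 * √(2 * energyBound T τ L) + √(2 * energyBound T τ L / τ)
    + √(T * (2 * energyBound T τ L / τ) + dissipationBound T τ L))

theorem stabilityConst_pos {T τ L : ℝ} (hT : 0 ≤ T) (hτ : 0 ≤ τ) (hL : 0 ≤ L) :
    0 < stabilityConst T τ L := by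
  have := energyBound_nonneg (L := L) hT hτ
  have := dissipationBound_nonneg hT hτ hL
  unfold stabilityConst; positivity

/-- The bounds on the energy and on the dissipation, expressed in the norms of the theorem. -/
theorem eLpNorm_add_le_of_energy_le {V H G : Type*} [NormedAddCommGroup V] [NormedSpace ℝ V]
    [NormedAddCommGroup H] [NormedSpace ℝ H] [NormedAddCommGroup G] [NormedSpace ℝ G]
    (P : V →L[ℝ] H) (D : V →L[ℝ] G) (hnorm : ∀ v, ‖v‖ ^ 2 = ‖P v‖ ^ 2 + ‖D v‖ ^ 2)
    {T α τ L R : ℝ} (hT : 0 < T) (hα : 0 < α) (hτ : 0 < τ) (hL : 0 ≤ L) (hR0 : 0 ≤ R)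
    {u : ℝ → H} {q : ℝ → G} {w : ℝ → V} (hw : MemLp w 2 (timeMeasure T))
    (hE : ∀ᵐ t ∂(timeMeasure T), α / 2 * ‖u t‖ ^ 2 + 1 / 2 * ‖q t‖ ^ 2 + τ / 2 * ‖P (w t)‖ ^ 2
      ≤ energyBound T τ L * R ^ 2)
    (hD : ∫ t, ‖D (w t)‖ ^ 2 ∂(timeMeasure T) ≤ dissipationBound T τ L * R ^ 2) :
    ENNReal.ofReal (√α) * eLpNorm u ∞ (timeMeasure T) + eLpNorm q ∞ (timeMeasure T)
      + (eLpNorm (fun t => P (w t)) ∞ (timeMeasure T) + eLpNorm w 2 (timeMeasure T))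
    ≤ ENNReal.ofReal (stabilityConst T τ L * R) := by
  have hs : 0 < √α := Real.sqrt_pos.2 hα
  have hB := energyBound_nonneg (L := L) hT.le hτ.le
  have hM := dissipationBound_nonneg hT.le hτ.le hL
  set B := energyBound T τ L with hBdef
  set M := dissipationBound T τ L with hMdef
  have hμ : eLpNorm u ∞ (timeMeasure T)
      ≤ ENNReal.ofReal √(B * R ^ 2 / (α / 2)) := by
    refine eLpNorm_top_le_of_sq_le (by positivity) ?_
    filter_upwards [hE] with t ht
    have : 0 ≤ 1 / 2 * ‖q t‖ ^ 2
      + τ / 2 * ‖P (w t)‖ ^ 2 := by positivity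
    linarith
  have hq : eLpNorm q ∞ (timeMeasure T)
      ≤ ENNReal.ofReal √(B * R ^ 2 / (1 / 2)) := by
    refine eLpNorm_top_le_of_sq_le (by positivity) ?_
    filter_upwards [hE] with t ht
    have : 0 ≤ α / 2 * ‖u t‖ ^ 2
      + τ / 2 * ‖P (w t)‖ ^ 2 := by positivity
    linarith
  have hφE : ∀ᵐ t ∂(timeMeasure T), τ / 2 * ‖P (w t)‖ ^ 2 ≤ B * R ^ 2 := by
    filter_upwards [hE] with t ht
    have : 0 ≤ α / 2 * ‖u t‖ ^ 2
      + 1 / 2 * ‖q t‖ ^ 2 := by positivity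
    linarith
  have hφ := eLpNorm_top_le_of_sq_le (half_pos hτ) hφE
  have i1 : Integrable (fun t => ‖P (w t)‖ ^ 2) (timeMeasure T) :=
    ((P).comp_memLp' hw).integrable_norm_pow two_ne_zero
  have i2 : Integrable (fun t => ‖D (w t)‖ ^ 2) (timeMeasure T) :=
    ((D).comp_memLp' hw).integrable_norm_pow two_ne_zero
  have hI : ∫ t, ‖w t‖ ^ 2 ∂(timeMeasure T) ≤ (T * (2 * B / τ) + M) * R ^ 2 := by
    simp only [hnorm]
    rw [integral_add i1 i2, add_mul]
    refine add_le_add ?_ hD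
    have : ∫ t, ‖P (w t)‖ ^ 2 ∂(timeMeasure T)
        ≤ ∫ _, 2 * B / τ * R ^ 2 ∂(timeMeasure T) := by
      refine integral_mono_ae i1 (integrable_const _) ?_
      filter_upwards [hφE] with t ht
      have e : 2 * B / τ * R ^ 2 = B * R ^ 2 / (τ / 2) := by field_simp
      rw [e, le_div_iff₀ (half_pos hτ)]
      linarith
    refine this.trans (le_of_eq ?_)
    rw [setIntegral_const, Real.volume_real_Ioo_of_le hT.le, smul_eq_mul]
    ring
  have hφ2 : eLpNorm w 2 (timeMeasure T)
      ≤ ENNReal.ofReal √((T * (2 * B / τ) + M) * R ^ 2) := by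
    rw [eLpNorm_two_eq hw]
    exact ENNReal.ofReal_le_ofReal (Real.sqrt_le_sqrt hI)
  have hsqR : √(R ^ 2) = R := Real.sqrt_sq hR0
  have r1 : √α * √(B * R ^ 2 / (α / 2)) = √(2 * B) * R := by
    rw [← hsqR, ← Real.sqrt_mul hα.le, ← Real.sqrt_mul (by positivity), hsqR]
    congr 1
    field_simp
  have r2 : √(B * R ^ 2 / (1 / 2)) = √(2 * B) * R := by
    rw [← hsqR, ← Real.sqrt_mul (by positivity), hsqR]
    congr 1
    ring
  have r3 : √(B * R ^ 2 / (τ / 2)) = √(2 * B / τ) * R := by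
    rw [← hsqR, ← Real.sqrt_mul (by positivity), hsqR]
    congr 1
    field_simp
  have r4 : √((T * (2 * B / τ) + M) * R ^ 2) = √(T * (2 * B / τ) + M) * R := by
    rw [Real.sqrt_mul (by positivity), hsqR]
  rw [r2] at hq
  rw [r3] at hφ
  rw [r4] at hφ2
  calc _ ≤ ENNReal.ofReal (√α) * ENNReal.ofReal √(B * R ^ 2 / (α / 2))
        + ENNReal.ofReal (√(2 * B) * R) + (ENNReal.ofReal (√(2 * B / τ) * R)
        + ENNReal.ofReal (√(T * (2 * B / τ) + M) * R)) := by gcongr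
    _ = ENNReal.ofReal (√(2 * B) * R + √(2 * B) * R + (√(2 * B / τ) * R
        + √(T * (2 * B / τ) + M) * R)) := by
      rw [← ENNReal.ofReal_mul hs.le, r1, ENNReal.ofReal_add, ENNReal.ofReal_add,
        ENNReal.ofReal_add] <;> positivity
    _ ≤ ENNReal.ofReal (stabilityConst T τ L * R) := by
      refine ENNReal.ofReal_le_ofReal ?_
      rw [stabilityConst, ← hBdef, ← hMdef]
      linarith

theorem data_terms_le {γ σ a b c : ℝ} (hγ : 0 ≤ γ) (hσ : 0 < σ) (ha : 0 ≤ a) (hb : 0 ≤ b)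
    (hc : 0 ≤ c) :
    γ ≤ γ + σ * a + σ * b + (1 + 1 / σ) * c ∧ σ * a ≤ γ + σ * a + σ * b + (1 + 1 / σ) * c ∧
    c ≤ γ + σ * a + σ * b + (1 + 1 / σ) * c ∧
    σ * b + c / σ ≤ γ + σ * a + σ * b + (1 + 1 / σ) * c := by
  have p1 : 0 ≤ σ * a := by positivity
  have p2 : 0 ≤ σ * b := by positivity
  have p3 : 0 ≤ c / σ := by positivity
  have p4 : (1 + 1 / σ) * c = c + c / σ := by ring
  rw [p4]
  refine ⟨?_, ?_, ?_, ?_⟩ <;> linarith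

theorem ofReal_mul_add_eq {K γ σ a b c : ℝ} (hK : 0 ≤ K) (hγ : 0 ≤ γ) (hσ : 0 ≤ σ) (ha : 0 ≤ a)
    (hb : 0 ≤ b) (hc : 0 ≤ c) :
    ENNReal.ofReal (K * (γ + σ * a + σ * b + (1 + 1 / σ) * c))
      = ENNReal.ofReal K * (ENNReal.ofReal γ + ENNReal.ofReal (σ * a) + ENNReal.ofReal (σ * b))
        + ENNReal.ofReal (K * (1 + 1 / σ) * c) := by
  rw [← ENNReal.ofReal_add hγ (by positivity), ← ENNReal.ofReal_add (by positivity) (by positivity),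
    ← ENNReal.ofReal_mul hK, ← ENNReal.ofReal_add (by positivity) (by positivity)]
  congr 1
  ring

namespace IsSolutionWith

variable {N : ℕ} {Ω : Set (EuclideanSpace ℝ (Fin N))}
variable {T α τ : ℝ} {f₁ : ℝ → ℝ≥0∞} {f₂ : ℝ → ℝ} {d : Data Ω} {μ : ℝ → V Ω} {φ : ℝ → W Ω}
  {ξ : ℝ → H Ω} {μt : ℝ → H Ω} {μtt : ℝ → VDual Ω} {φt : ℝ → V Ω}
variable {d' : Data Ω} {μ' : ℝ → V Ω} {φ' : ℝ → W Ω}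
  {ξ' : ℝ → H Ω} {μt' : ℝ → H Ω} {μtt' : ℝ → VDual Ω} {φt' : ℝ → V Ω}

theorem stability_estimate (hΩ : IsSmoothDomain Ω) (hT : 0 < T) (hα : 0 < α) (hτ : 0 < τ)
    {L : ℝ≥0} (hf : IsPotential f₁ f₂ L)
    (s : IsSolutionWith T α τ f₁ f₂ d μ φ ξ μt μtt φt)
    (s' : IsSolutionWith T α τ f₁ f₂ d' μ' φ' ξ' μt' μtt' φt')
    (hg : MemLp d.g 2 (timeMeasure T)) (hg' : MemLp d'.g 2 (timeMeasure T)) :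
    ENNReal.ofReal (√α) * eLpNorm (fun t => toH Ω (μ t - μ' t)) ∞ (timeMeasure T)
      + eLpNorm (fun t => grad Ω (oneConv (fun s => μ s - μ' s) t)) ∞ (timeMeasure T)
      + (eLpNorm (fun t => toH Ω (toV Ω (φ t - φ' t))) ∞ (timeMeasure T)
        + eLpNorm (fun t => toV Ω (φ t - φ' t)) 2 (timeMeasure T))
    ≤ ENNReal.ofReal (stabilityConst T τ L) *
        (eLpNorm (fun t => d.g t - d'.g t) 2 (timeMeasure T)
          + ENNReal.ofReal (√α * ‖toH Ω (d.μ₀ - d'.μ₀)‖)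
          + ENNReal.ofReal (√α * ‖d.ν₀ - d'.ν₀‖))
      + ENNReal.ofReal
          (stabilityConst T τ L * (1 + 1 / √α) * ‖toH Ω (toV Ω (d.φ₀ - d'.φ₀))‖) := by
  have hL : (0 : ℝ) ≤ L := L.2
  have hγ := Real.sqrt_nonneg (∫ t, ‖d.g t - d'.g t‖ ^ 2 ∂(timeMeasure T))
  have hs : 0 < √α := Real.sqrt_pos.2 hα
  have ha := norm_nonneg (toH Ω (d.μ₀ - d'.μ₀))
  have hb := norm_nonneg (d.ν₀ - d'.ν₀)
  have hc := norm_nonneg (toH Ω (toV Ω (d.φ₀ - d'.φ₀)))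
  obtain ⟨h1, h2, h3, h4⟩ := data_terms_le hγ hs ha hb hc
  have hR := hγ.trans h1
  have key := energy_estimate_sub hΩ hT hα hτ hf s s' hg hg' h2 h3 h4 ((Real.sqrt_le_left hR).1 h1)
  have iφ : MemLp (fun t => toV Ω (φ t - φ' t)) 2 (timeMeasure T) := by
    simp only [toV_sub]
    exact s.memLp_toV_φ.sub s'.memLp_toV_φ
  refine (eLpNorm_add_le_of_energy_le (toH Ω) (grad Ω) norm_sq_eq_toH_add_grad hT hα hτ hL hR iφ
    key.1 key.2).trans (le_of_eq ?_)
  rw [eLpNorm_two_eq (u := fun t => d.g t - d'.g t) (hg.sub hg')]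
  exact ofReal_mul_add_eq (stabilityConst_pos hT.le hτ.le hL).le hγ hs.le ha hb hc

end IsSolutionWith

end HypRelax

theorem theorem2p3 {N : ℕ} (hN : 1 ≤ N ∧ N ≤ 3) (Ω : Set (EuclideanSpace ℝ (Fin N)))
    (hΩ : IsSmoothDomain Ω) (T : ℝ) (hT : 0 < T) (τ : ℝ) (hτ : 0 < τ) :
    -- the stability estimate, with a constant depending only on `Ω`, `T`, `τ`, `L`
    (∀ L : ℝ≥0, ∃ K₂ : ℝ, 0 < K₂ ∧
      ∀ (f₁ : ℝ → ℝ≥0∞) (f₂ : ℝ → ℝ), IsPotential f₁ f₂ L →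
      ∀ α : ℝ, 0 < α → α ≤ 1 →
      ∀ d₁ d₂ : Data Ω, d₁.IsAdmissible T f₁ → d₂.IsAdmissible T f₁ →
      ∀ (μ₁ μ₂ : ℝ → V Ω) (φ₁ φ₂ : ℝ → W Ω) (ξ₁ ξ₂ : ℝ → H Ω),
      IsSolution T α τ f₁ f₂ d₁ μ₁ φ₁ ξ₁ → IsSolution T α τ f₁ f₂ d₂ μ₂ φ₂ ξ₂ →
        ENNReal.ofReal (√α) * eLpNorm (fun t => toH Ω (μ₁ t - μ₂ t)) ∞ (timeMeasure T)
          + eLpNorm (fun t => grad Ω (oneConv (fun s => μ₁ s - μ₂ s) t)) ∞ (timeMeasure T)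
          + (eLpNorm (fun t => toH Ω (toV Ω (φ₁ t - φ₂ t))) ∞ (timeMeasure T)
            + eLpNorm (fun t => toV Ω (φ₁ t - φ₂ t)) 2 (timeMeasure T))
        ≤ ENNReal.ofReal K₂ *
            (eLpNorm (fun t => d₁.g t - d₂.g t) 2 (timeMeasure T)
              + ENNReal.ofReal (√α * ‖toH Ω (d₁.μ₀ - d₂.μ₀)‖)
              + ENNReal.ofReal (√α * ‖d₁.ν₀ - d₂.ν₀‖))
          + ENNReal.ofReal (K₂ * (1 + 1 / √α) * ‖toH Ω (toV Ω (d₁.φ₀ - d₂.φ₀))‖)) ∧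
    -- uniqueness of the solution
    (∀ (L : ℝ≥0) (f₁ : ℝ → ℝ≥0∞) (f₂ : ℝ → ℝ), IsPotential f₁ f₂ L →
      ∀ α : ℝ, 0 < α → α ≤ 1 →
      ∀ d : Data Ω, d.IsAdmissible T f₁ →
      ∀ (μ₁ μ₂ : ℝ → V Ω) (φ₁ φ₂ : ℝ → W Ω) (ξ₁ ξ₂ : ℝ → H Ω),
      IsSolution T α τ f₁ f₂ d μ₁ φ₁ ξ₁ → IsSolution T α τ f₁ f₂ d μ₂ φ₂ ξ₂ →
        μ₁ =ᵐ[timeMeasure T] μ₂ ∧ φ₁ =ᵐ[timeMeasure T] φ₂ ∧ ξ₁ =ᵐ[timeMeasure T] ξ₂) := by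
  constructor
  · intro L
    refine ⟨stabilityConst T τ L, stabilityConst_pos hT.le hτ.le L.2, ?_⟩
    rintro f₁ f₂ hf α hα - d₁ d₂ h₁ h₂ μ₁ μ₂ φ₁ φ₂ ξ₁ ξ₂ ⟨μt₁, μtt₁, φt₁, s₁⟩ ⟨μt₂, μtt₂, φt₂, s₂⟩
    exact s₁.stability_estimate hΩ hT hα hτ hf s₂ h₁.g_mem h₂.g_mem
  · rintro L f₁ f₂ hf α hα - d hd μ₁ μ₂ φ₁ φ₂ ξ₁ ξ₂ ⟨μt₁, μtt₁, φt₁, s₁⟩ ⟨μt₂, μtt₂, φt₂, s₂⟩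
    exact s₁.ae_eq_of_same_data hΩ hT hα hτ hf hd.g_mem s₂
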